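/- Let $n\ge 3$ and let $\mathcal T$ be the regular rooted $n$-ary tree: its vertices are the finite words over $X=\{1,\dots,n\}$, its root is the empty word, and each word $u$ is joined by an edge to $ux$ for every $x\in X$. Let $\mathrm{Aut}(\mathcal T)$ be the group of bijections of the vertex set that fix the root and preserve edge incidences, and for $m\ge 0$ and a subgroup $H$ let $\mathrm{Stab}_H(m)$ be the subgroup of the elements of $H$ that fix every word of length $m$. Write $g=(g_1,\dots,g_n)\sigma$ if $g$ moves the first letter of a word by the permutation $\sigma$ of $X$ and moves the rest of a word that begins with $i$ by $g_i\in\mathrm{Aut}(\mathcal T)$. For $1\le i\le n$ let $\sigma_i$ be the cycle $(1,2,\dots,i-1,i+1,\dots,n)$, let $a_i\in\mathrm{Aut}(\mathcal T)$ be defined recursively by $a_i=(1,\dots,1,a_i,1,\dots,1)\sigma_i$, with $a_i$ in the $i$-th coordinate, and let $G_n=\langle a_1,\dots,a_n\rangle$. Equip $\mathrm{Aut}(\mathcal T)$ with the metric \[d(g,h)=\inf\{\,|\mathrm{Aut}(\mathcal T):\mathrm{Stab}_{\mathrm{Aut}(\mathcal T)}(m)|^{-1} \mid m\ge 0,\ g^{-1}h\in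 \mathrm{Stab}_{\mathrm{Aut}(\mathcal T)}(m)\,\},\] and let $\overline{G_n}$ be the closure of $G_n$ in $\mathrm{Aut}(\mathcal T)$. Then the Hausdorff dimension of $\overline{G_n}$ with respect to $d$ is given by \[ \dim_{\mathrm H}(\overline{G_n})=\liminf_{m\to\infty}\frac{\log|\overline{G_n}/\mathrm{Stab}_{\overline{G_n}}(m)|}{\log|\mathrm{Aut}(\mathcal T)/\mathrm{Stab}_{\mathrm{Aut}(\mathcal T)}(m)|}= \begin{cases} 1-\dfrac{\log 48}{\log 331776} & \text{if } n=4,\\[2mm] 1-\dfrac{\log 2}{\log (n!)} & \text{if } n\ge 5 \text{ is even},\\[2mm] 1-\dfrac{\log 2}{n\log (n!)} & \text{if } n \text{ is odd}. \end{cases} \] -/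

import Mathlib

open scoped ENNReal

/-- The regular rooted `n`-ary tree: its vertices are the finite words over the alphabet `Fin n`
(the root is the empty word), and `u` is joined to `u ++ [x]` for every letter `x`. -/
def treeGraph (n : ℕ) : SimpleGraph (List (Fin n)) where
  Adj u v := (∃ x, v = u ++ [x]) ∨ (∃ x, u = v ++ [x])
  symm := ⟨fun _ _ h => h.symm⟩
  loopless := ⟨by rintro u (⟨x, h⟩ | ⟨x, h⟩) <;> simpa using congrArg List.length h⟩

/-- The bijections of the vertex set that fix the root and preserve edge incidences. -/
def treeAutSubgroup (n : ℕ) : Subgroup (Equiv.Perm (List (Fin n))) where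
  carrier := {g | g [] = [] ∧ ∀ u v, (treeGraph n).Adj (g u) (g v) ↔ (treeGraph n).Adj u v}
  one_mem' := ⟨rfl, fun _ _ => Iff.rfl⟩
  mul_mem' := by
    rintro g h ⟨hg, hg'⟩ ⟨hh, hh'⟩
    refine ⟨?_, fun u v => ?_⟩
    · rw [Equiv.Perm.mul_apply, hh, hg]
    · rw [Equiv.Perm.mul_apply, Equiv.Perm.mul_apply, hg', hh']
  inv_mem' := by
    rintro g ⟨hg, hg'⟩
    refine ⟨?_, fun u v => ?_⟩
    · rw [Equiv.Perm.inv_eq_iff_eq, hg]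
    · rw [← hg' (g⁻¹ u) (g⁻¹ v)]
      simp

/-- The group `Aut(T)` of automorphisms of the regular rooted `n`-ary tree `T`. -/
def TreeAut (n : ℕ) : Type := treeAutSubgroup n

namespace TreeAut

instance (n : ℕ) : Group (TreeAut n) := inferInstanceAs (Group (treeAutSubgroup n))

instance (n : ℕ) : MulAction (TreeAut n) (List (Fin n)) :=
  inferInstanceAs (MulAction (treeAutSubgroup n) (List (Fin n)))

instance (n : ℕ) : FaithfulSMul (TreeAut n) (List (Fin n)) :=
  inferInstanceAs (FaithfulSMul (treeAutSubgroup n) (List (Fin n)))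

/-- The `m`-th level stabilizer of `Aut(T)`: the intersection of the stabilizers of the vertices
of level `m`. -/
def levelStab (n m : ℕ) : Subgroup (TreeAut n) :=
  ⨅ u : {u : List (Fin n) // u.length = m}, MulAction.stabilizer (TreeAut n) u.1

variable {n : ℕ}

theorem smul_nil (g : TreeAut n) : g • ([] : List (Fin n)) = [] := g.2.1

theorem adj_smul_iff (g : TreeAut n) (u v : List (Fin n)) :
    (treeGraph n).Adj (g • u) (g • v) ↔ (treeGraph n).Adj u v := g.2.2 u v

theorem mem_levelStab {m : ℕ} {g : TreeAut n} :
    g ∈ levelStab n m ↔ ∀ u : List (Fin n), u.length = m → g • u = u := by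
  simp [levelStab, Subgroup.mem_iInf, MulAction.mem_stabilizer_iff]

theorem exists_smul_concat (g : TreeAut n) (u : List (Fin n)) :
    ∀ x, ∃ y, g • (u ++ [x]) = g • u ++ [y] := by
  induction u using List.reverseRecOn with
  | nil =>
    intro x
    have h := (adj_smul_iff g [] ([] ++ [x])).2 (Or.inl ⟨x, rfl⟩)
    rcases h with ⟨y, hy⟩ | ⟨y, hy⟩
    · exact ⟨y, hy⟩
    · rw [smul_nil] at hy
      simp at hy
  | append_singleton v z ih =>
    intro x
    have h := (adj_smul_iff g (v ++ [z]) (v ++ [z] ++ [x])).2 (Or.inl ⟨x, rfl⟩)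
    rcases h with ⟨y, hy⟩ | ⟨y, hy⟩
    · exact ⟨y, hy⟩
    · obtain ⟨z', hz'⟩ := ih z
      rw [hz'] at hy
      have h1 := (List.append_inj' hy rfl).1
      have h2 := congrArg List.length (MulAction.injective g h1)
      simp only [List.length_append, List.length_singleton] at h2
      omega

theorem length_smul (g : TreeAut n) (u : List (Fin n)) : (g • u).length = u.length := by
  induction u using List.reverseRecOn with
  | nil => rw [smul_nil]
  | append_singleton v z ih =>
    obtain ⟨y, hy⟩ := exists_smul_concat g v z
    rw [hy, List.length_append, List.length_append, ih]
    rfl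

theorem exists_smul_append (g : TreeAut n) (u w : List (Fin n)) :
    ∃ w', g • (u ++ w) = g • u ++ w' := by
  induction w using List.reverseRecOn with
  | nil => exact ⟨[], by simp⟩
  | append_singleton w z ih =>
    obtain ⟨w', hw'⟩ := ih
    obtain ⟨y, hy⟩ := exists_smul_concat g (u ++ w) z
    exact ⟨w' ++ [y], by rw [← List.append_assoc, hy, hw', List.append_assoc]⟩

theorem levelStab_antitone : Antitone (levelStab n) := by
  intro m m' hmm' g hg
  rw [mem_levelStab] at hg ⊢
  intro u hu
  rcases u with _ | ⟨x, u⟩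
  · exact smul_nil g
  · have h := hg ((x :: u) ++ List.replicate (m' - m) x) (by
      rw [List.length_append, hu, List.length_replicate]; omega)
    obtain ⟨w', hw'⟩ := exists_smul_append g (x :: u) (List.replicate (m' - m) x)
    rw [hw'] at h
    exact (List.append_inj h (length_smul g _)).1

theorem levelStab_zero : levelStab n 0 = ⊤ := by
  rw [eq_top_iff]
  intro g _
  rw [mem_levelStab]
  intro u hu
  rw [List.length_eq_zero_iff.1 hu, smul_nil]

instance levelStab_normal (m : ℕ) : (levelStab n m).Normal where
  conj_mem h hh g := by
    rw [mem_levelStab] at hh ⊢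
    intro u hu
    rw [mul_smul, mul_smul, hh _ (by rw [length_smul, hu]), smul_inv_smul]

instance levelStab_finiteIndex (m : ℕ) : (levelStab n m).FiniteIndex := by
  have : Finite {u : List (Fin n) // u.length = m} := (List.finite_length_eq (Fin n) m).to_subtype
  refine Subgroup.finiteIndex_iInf fun u => ⟨?_⟩
  rw [MulAction.index_stabilizer]
  have hfin : (MulAction.orbit (TreeAut n) u.1).Finite := by
    refine (List.finite_length_eq (Fin n) m).subset ?_
    rintro _ ⟨g, rfl⟩
    exact (length_smul g u.1).trans u.2
  exact (Set.ncard_pos hfin).2 ⟨u.1, MulAction.mem_orbit_self u.1⟩ |>.ne'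

theorem eq_of_forall_mem_levelStab {g h : TreeAut n} (H : ∀ m, g⁻¹ * h ∈ levelStab n m) :
    g = h := by
  refine FaithfulSMul.eq_of_smul_eq_smul (α := List (Fin n)) fun u => ?_
  have := mem_levelStab.1 (H u.length) u rfl
  rw [mul_smul, inv_smul_eq_iff] at this
  exact this.symm

/-- The metric of the filtration of `Aut(T)` by level stabilizers: the distance of `g ≠ h` is the
infimum of the numbers `1 / |Aut(T) : Stab(m)|` over all `m` with `g⁻¹ h ∈ Stab(m)`.
(The value `0` for `g = h` is also this infimum when `n ≥ 2`.) -/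
noncomputable def levelDist (g h : TreeAut n) : ℝ :=
  open Classical in
  if g = h then 0
  else ⨅ m : {m : ℕ // g⁻¹ * h ∈ levelStab n m}, ((levelStab n m.1).index : ℝ)⁻¹

theorem levelDist_self (g : TreeAut n) : levelDist g g = 0 := if_pos rfl

theorem levelDist_of_ne {g h : TreeAut n} (hgh : g ≠ h) : levelDist g h =
    ⨅ m : {m : ℕ // g⁻¹ * h ∈ levelStab n m}, ((levelStab n m.1).index : ℝ)⁻¹ := if_neg hgh

theorem index_pos (m : ℕ) : (0 : ℝ) < (levelStab n m).index := by
  exact_mod_cast Nat.pos_of_ne_zero Subgroup.FiniteIndex.index_ne_zero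

theorem index_mono {m m' : ℕ} (h : m ≤ m') :
    ((levelStab n m).index : ℝ) ≤ (levelStab n m').index := by
  exact_mod_cast Nat.le_of_dvd (Nat.pos_of_ne_zero Subgroup.FiniteIndex.index_ne_zero)
    (Subgroup.index_dvd_of_le (levelStab_antitone h))

theorem nonempty_levels (g h : TreeAut n) : Nonempty {m : ℕ // g⁻¹ * h ∈ levelStab n m} :=
  ⟨⟨0, by rw [levelStab_zero]; trivial⟩⟩

theorem levelDist_nonneg (g h : TreeAut n) : 0 ≤ levelDist g h := by
  rw [levelDist]
  split_ifs
  · exact le_rfl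
  · exact Real.iInf_nonneg fun m => by positivity

theorem levelDist_le {g h : TreeAut n} {m : ℕ} (H : g⁻¹ * h ∈ levelStab n m) :
    levelDist g h ≤ ((levelStab n m).index : ℝ)⁻¹ := by
  rw [levelDist]
  split_ifs
  · positivity
  · exact ciInf_le (f := fun m : {m : ℕ // g⁻¹ * h ∈ levelStab n m} =>
      ((levelStab n m.1).index : ℝ)⁻¹) ⟨0, by rintro _ ⟨m, rfl⟩; positivity⟩ ⟨m, H⟩

theorem le_levelDist {g h : TreeAut n} {m : ℕ} (H : g⁻¹ * h ∉ levelStab n m) :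
    ((levelStab n m).index : ℝ)⁻¹ ≤ levelDist g h := by
  have hgh : g ≠ h := by
    rintro rfl
    exact H (by rw [inv_mul_cancel]; exact one_mem _)
  have := nonempty_levels g h
  rw [levelDist_of_ne hgh]
  refine le_ciInf fun a => inv_anti₀ (index_pos _) (index_mono ?_)
  by_contra! hlt
  exact H (levelStab_antitone hlt.le a.2)

theorem levelDist_congr {g h g' h' : TreeAut n}
    (e : ∀ m, g⁻¹ * h ∈ levelStab n m ↔ g'⁻¹ * h' ∈ levelStab n m) :
    levelDist g h = levelDist g' h' := by
  by_cases hgh : g = h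
  · have : g' = h' := eq_of_forall_mem_levelStab fun m => (e m).1 (by
      rw [hgh, inv_mul_cancel]; exact one_mem _)
    rw [hgh, this, levelDist_self, levelDist_self]
  · have : g' ≠ h' := fun H => hgh (eq_of_forall_mem_levelStab fun m => (e m).2 (by
      rw [H, inv_mul_cancel]; exact one_mem _))
    rw [levelDist_of_ne hgh, levelDist_of_ne this]
    exact Equiv.iInf_congr (Equiv.subtypeEquivRight e) fun _ => rfl

theorem levelDist_mul_left (k g h : TreeAut n) : levelDist (k * g) (k * h) = levelDist g h := by
  exact levelDist_congr fun m => by rw [show (k * g)⁻¹ * (k * h) = g⁻¹ * h by group]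

theorem levelDist_mul_right (k g h : TreeAut n) : levelDist (g * k) (h * k) = levelDist g h := by
  have e : ∀ m, (g * k)⁻¹ * (h * k) ∈ levelStab n m ↔ g⁻¹ * h ∈ levelStab n m := fun m => by
    rw [show (g * k)⁻¹ * (h * k) = k⁻¹ * (g⁻¹ * h * k) by group,
      (levelStab_normal m).mem_comm_iff, mul_inv_cancel_right]
  exact levelDist_congr e

theorem levelDist_comm (g h : TreeAut n) : levelDist g h = levelDist h g := by
  have e : ∀ m, g⁻¹ * h ∈ levelStab n m ↔ h⁻¹ * g ∈ levelStab n m := fun m => by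
    rw [← inv_mem_iff (x := g⁻¹ * h), mul_inv_rev, inv_inv]
  exact levelDist_congr e

theorem levelDist_triangle (g h k : TreeAut n) :
    levelDist g k ≤ levelDist g h + levelDist h k := by
  rcases eq_or_ne g h with rfl | hgh
  · rw [levelDist_self, zero_add]
  rcases eq_or_ne h k with rfl | hhk
  · rw [levelDist_self, add_zero]
  have := nonempty_levels g h
  have := nonempty_levels h k
  rw [levelDist_of_ne hgh, levelDist_of_ne hhk]
  refine le_ciInf_add_ciInf fun a b => ?_
  have hmin : g⁻¹ * k ∈ levelStab n (min a.1 b.1) := by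
    rw [show g⁻¹ * k = (g⁻¹ * h) * (h⁻¹ * k) by group]
    exact mul_mem (levelStab_antitone (min_le_left _ _) a.2)
      (levelStab_antitone (min_le_right _ _) b.2)
  refine (levelDist_le hmin).trans ?_
  have ha := inv_pos.2 (index_pos (n := n) a.1)
  have hb := inv_pos.2 (index_pos (n := n) b.1)
  rcases min_choice a.1 b.1 with h' | h' <;> rw [h'] <;> linarith

noncomputable instance : MetricSpace (TreeAut n) where
  dist := levelDist
  dist_self := levelDist_self
  dist_comm := levelDist_comm
  dist_triangle := levelDist_triangle
  eq_of_dist_eq_zero := by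
    intro g h (h0 : levelDist g h = 0)
    refine eq_of_forall_mem_levelStab fun M => ?_
    by_contra hM
    exact absurd (inv_pos.2 (index_pos (n := n) M)) (not_lt.2 (h0 ▸ le_levelDist hM))

theorem dist_eq_levelDist (g h : TreeAut n) : dist g h = levelDist g h := rfl

instance : IsTopologicalGroup (TreeAut n) where
  continuous_mul := by
    have : LipschitzWith 2 fun p : TreeAut n × TreeAut n => p.1 * p.2 := by
      refine LipschitzWith.of_dist_le_mul fun p q => ?_
      have h1 : dist (p.1 * p.2) (q.1 * p.2) = dist p.1 q.1 := levelDist_mul_right _ _ _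
      have h2 : dist (q.1 * p.2) (q.1 * q.2) = dist p.2 q.2 := levelDist_mul_left _ _ _
      have h3 := dist_triangle (p.1 * p.2) (q.1 * p.2) (q.1 * q.2)
      have h4 : dist p.1 q.1 ≤ dist p q := le_max_left _ _
      have h5 : dist p.2 q.2 ≤ dist p q := le_max_right _ _
      push_cast
      linarith
    exact this.continuous
  continuous_inv := by
    have : Isometry fun g : TreeAut n => g⁻¹ := Isometry.of_dist_eq fun g h => by
      have h1 := levelDist_mul_left g g⁻¹ h⁻¹
      have h2 := levelDist_mul_right h 1 (g * h⁻¹)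
      rw [one_mul, inv_mul_cancel_right] at h2
      rw [mul_inv_cancel] at h1
      rw [dist_eq_levelDist, dist_eq_levelDist, ← h1, ← h2, levelDist_comm h g]
    exact this.continuous

end TreeAut

/-- The cycle `(1, 2, …, i-1, i+1, …, n)` of the symmetric group on `n` letters. -/
def sigmaPerm (n : ℕ) (i : Fin n) : Equiv.Perm (Fin n) :=
  ((List.finRange n).filter (· ≠ i)).formPerm

/-- The action on words of the automorphism `a = (1, …, 1, a, 1, …, 1) σ`, with `a` in the `i`-th
coordinate: the first letter is moved by `σ`, and the rest of the word is moved by the state of `a`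
at the first letter, which is `a` if that letter is `i`, and trivial otherwise. -/
def wordMap {n : ℕ} (σ : Equiv.Perm (Fin n)) (i : Fin n) : List (Fin n) → List (Fin n)
  | [] => []
  | x :: w => σ x :: if x = i then wordMap σ i w else w

/-- The inverse of `wordMap σ i`. -/
def wordMapInv {n : ℕ} (σ : Equiv.Perm (Fin n)) (i : Fin n) : List (Fin n) → List (Fin n)
  | [] => []
  | x :: w => σ.symm x :: if σ.symm x = i then wordMapInv σ i w else w

/-- `wordMap σ i` as a permutation of the set of words. -/
def wordPerm {n : ℕ} (σ : Equiv.Perm (Fin n)) (i : Fin n) : Equiv.Perm (List (Fin n)) where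
  toFun := wordMap σ i
  invFun := wordMapInv σ i
  left_inv w := by
    induction w with
    | nil => rfl
    | cons x w ih =>
      by_cases h : x = i <;> simp_all [wordMap, wordMapInv]
  right_inv w := by
    induction w with
    | nil => rfl
    | cons x w ih =>
      by_cases h : σ.symm x = i
      · have h' : σ i = x := by rw [← h, Equiv.apply_symm_apply]
        simp [wordMap, wordMapInv, h, ih, h']
      · simp [wordMap, wordMapInv, h]

theorem wordMap_concat {n : ℕ} (σ : Equiv.Perm (Fin n)) (i : Fin n) (u : List (Fin n)) (x : Fin n) :
    ∃ y, wordMap σ i (u ++ [x]) = wordMap σ i u ++ [y] := by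
  induction u with
  | nil => exact ⟨σ x, by simp [wordMap]⟩
  | cons z u ih =>
    obtain ⟨y, hy⟩ := ih
    by_cases h : z = i
    · exact ⟨y, by simp [wordMap, h, hy]⟩
    · exact ⟨x, by simp [wordMap, h]⟩

theorem wordMapInv_concat {n : ℕ} (σ : Equiv.Perm (Fin n)) (i : Fin n) (u : List (Fin n))
    (x : Fin n) : ∃ y, wordMapInv σ i (u ++ [x]) = wordMapInv σ i u ++ [y] := by
  induction u with
  | nil => exact ⟨σ.symm x, by simp [wordMapInv]⟩
  | cons z u ih =>
    obtain ⟨y, hy⟩ := ih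
    by_cases h : σ.symm z = i
    · exact ⟨y, by simp [wordMapInv, h, hy]⟩
    · exact ⟨x, by simp [wordMapInv, h]⟩

/-- The generator `a_i = (1, …, 1, a_i, 1, …, 1) σ_i`, with `a_i` in the `i`-th coordinate. -/
def hanoiGen (n : ℕ) (i : Fin n) : TreeAut n :=
  ⟨wordPerm (sigmaPerm n i) i, rfl, fun u v => by
    have A : ∀ u v, (treeGraph n).Adj u v →
        (treeGraph n).Adj (wordMap (sigmaPerm n i) i u) (wordMap (sigmaPerm n i) i v) := by
      rintro u v (⟨x, rfl⟩ | ⟨x, rfl⟩)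
      · exact Or.inl (wordMap_concat _ _ _ _)
      · exact Or.inr (wordMap_concat _ _ _ _)
    have B : ∀ u v, (treeGraph n).Adj u v →
        (treeGraph n).Adj (wordMapInv (sigmaPerm n i) i u) (wordMapInv (sigmaPerm n i) i v) := by
      rintro u v (⟨x, rfl⟩ | ⟨x, rfl⟩)
      · exact Or.inl (wordMapInv_concat _ _ _ _)
      · exact Or.inr (wordMapInv_concat _ _ _ _)
    refine ⟨fun h => ?_, A u v⟩
    have := B _ _ h
    rwa [show wordMapInv (sigmaPerm n i) i (wordPerm (sigmaPerm n i) i u) = u from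
        (wordPerm (sigmaPerm n i) i).left_inv u,
      show wordMapInv (sigmaPerm n i) i (wordPerm (sigmaPerm n i) i v) = v from
        (wordPerm (sigmaPerm n i) i).left_inv v] at this⟩

/-- The generalized Hanoi towers group `G_n`, generated by `a_1, …, a_n`. -/
def hanoiGroup (n : ℕ) : Subgroup (TreeAut n) :=
  Subgroup.closure (Set.range (hanoiGen n))

/-! For a closed subgroup `K`, if the ratio log |K/Stab_K(m)| / log |Aut(T)/Stab(m)| converges, its
limit is the Hausdorff dimension: cosets of level stabilizers give the upper bound, Haar measure and
the mass distribution principle the lower one (`dimH_eq_of_tendsto`). Closing up a subgroup does not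
change its finite quotients (`relIndex_topologicalClosure`), so everything reduces to counting in G
= G_n.

Let Σ be the group generated by the σ_i. For a generator, the product over the letters of the
classes in Σ^ab of the actions of its states equals the class of its own action on the letters, and
this relation is multiplicative (`prod_secClass`). Hence an element of Stab_G(1) acts on the second
level by a tuple in N = {f ∈ Σ^n : ∏ [f x] = 1} (`levelOneGroup`), a group of order |Σ|^n / |Σ^ab|.
If every tuple of N occurs and the pattern repeats independently below every vertex, then
|G/Stab_G(m+1)| = |Σ| |N|^(1+n+…+n^(m-1)) and the dimension is log |N| / (n log n!).

Both facts follow from a subgroup B, normal in G, which contains its own copy below each letter,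
induces at least [Σ,Σ] on the letters, and contains elements fixing the letters with class vectors
a, a⁻¹ at two letters and 1 elsewhere (`HasBranchingSubgroup`). For n ≥ 4 one takes B = [[E,E],E],
where E is the normal closure of the a_i a_{i+1}⁻¹ (`hanoiEven`): the cube of a_i a_{i+1}⁻¹ lives
below three letters only, and commutators intersect supports (`single_mem_commutator`). For n = 3
one takes B = [G,G].

Finally Σ is the symmetric group for odd n and the alternating group for even n, so |Σ^ab| is 2 for
odd n, 3 for n = 4, and 1 for even n ≥ 6. The exceptional value at n = 4 comes from the
abelianization of A_4. -/

namespace TreeAut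

/-! ### Automorphisms as an action on the letters together with a tuple of states -/

variable {n : ℕ}

/-- A permutation of the words which, together with its inverse, extends prefixes letter by letter
is an automorphism of the tree. -/
def ofPerm (f : Equiv.Perm (List (Fin n))) (h0 : f [] = [])
    (hf : ∀ u x, ∃ y, f (u ++ [x]) = f u ++ [y])
    (hf' : ∀ u x, ∃ y, f.symm (u ++ [x]) = f.symm u ++ [y]) : TreeAut n :=
  ⟨f, h0, fun u v => by
    have A : ∀ u v, (treeGraph n).Adj u v → (treeGraph n).Adj (f u) (f v) := by
      rintro u v (⟨x, rfl⟩ | ⟨x, rfl⟩)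
      · exact Or.inl (hf _ _)
      · exact Or.inr (hf _ _)
    have B : ∀ u v, (treeGraph n).Adj u v → (treeGraph n).Adj (f.symm u) (f.symm v) := by
      rintro u v (⟨x, rfl⟩ | ⟨x, rfl⟩)
      · exact Or.inl (hf' _ _)
      · exact Or.inr (hf' _ _)
    exact ⟨fun h => by simpa using B _ _ h, A u v⟩⟩

theorem exists_smul_singleton (g : TreeAut n) (x : Fin n) : ∃ y, g • [x] = [y] := by
  obtain ⟨y, hy⟩ := exists_smul_concat g [] x
  exact ⟨y, by simpa [smul_nil] using hy⟩

/-- The action of an automorphism on the first letter, as a map. -/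
noncomputable def rootFun (g : TreeAut n) (x : Fin n) : Fin n := (exists_smul_singleton g x).choose

theorem smul_singleton' (g : TreeAut n) (x : Fin n) : g • [x] = [rootFun g x] :=
  (exists_smul_singleton g x).choose_spec

theorem rootFun_inv (g : TreeAut n) (x : Fin n) : rootFun g⁻¹ (rootFun g x) = x := by
  have h := smul_singleton' g⁻¹ (rootFun g x)
  rw [← smul_singleton', inv_smul_smul] at h
  simpa using h.symm

/-- The action of an automorphism on the first letter. -/
noncomputable def root (g : TreeAut n) : Equiv.Perm (Fin n) where
  toFun := rootFun g
  invFun := rootFun g⁻¹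
  left_inv := rootFun_inv g
  right_inv x := by simpa using rootFun_inv g⁻¹ x

theorem smul_singleton (g : TreeAut n) (x : Fin n) : g • [x] = [root g x] := smul_singleton' g x

theorem exists_smul_cons (g : TreeAut n) (x : Fin n) (w : List (Fin n)) :
    ∃ w', g • (x :: w) = root g x :: w' := by
  obtain ⟨w', hw'⟩ := exists_smul_append g [x] w
  exact ⟨w', by simpa [smul_singleton] using hw'⟩

theorem smul_cons_tail (g : TreeAut n) (x : Fin n) (w : List (Fin n)) :
    g • (x :: w) = root g x :: (g • (x :: w)).tail := by
  obtain ⟨w', hw'⟩ := exists_smul_cons g x w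
  rw [hw', List.tail_cons]

theorem root_inv_apply_root (g : TreeAut n) (x : Fin n) : root g⁻¹ (root g x) = x :=
  rootFun_inv g x

theorem sec_aux (g : TreeAut n) (x : Fin n) (w : List (Fin n)) :
    (g⁻¹ • (root g x :: (g • (x :: w)).tail)).tail = w := by
  rw [← smul_cons_tail, inv_smul_smul, List.tail_cons]

theorem sec_concat_aux (g : TreeAut n) (x : Fin n) (u : List (Fin n)) (y : Fin n) :
    ∃ z, (g • (x :: (u ++ [y]))).tail = (g • (x :: u)).tail ++ [z] := by
  obtain ⟨z, hz⟩ := exists_smul_concat g (x :: u) y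
  refine ⟨z, ?_⟩
  rw [List.cons_append] at hz
  rw [hz, smul_cons_tail g x u]
  simp

/-- The state (section) of an automorphism at a letter. -/
noncomputable def sec (g : TreeAut n) (x : Fin n) : TreeAut n :=
  ofPerm
    { toFun := fun w => (g • (x :: w)).tail
      invFun := fun w => (g⁻¹ • (root g x :: w)).tail
      left_inv := sec_aux g x
      right_inv := fun w => by
        have := sec_aux g⁻¹ (root g x) w
        rwa [root_inv_apply_root, inv_inv] at this }
    (by
      have := smul_singleton g x
      simp [this])
    (sec_concat_aux g x) (sec_concat_aux g⁻¹ (root g x))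

theorem smul_cons (g : TreeAut n) (x : Fin n) (w : List (Fin n)) :
    g • (x :: w) = root g x :: sec g x • w := smul_cons_tail g x w

theorem ext_smul {g h : TreeAut n} (H : ∀ u : List (Fin n), g • u = h • u) : g = h :=
  FaithfulSMul.eq_of_smul_eq_smul H

theorem root_sec_unique {g : TreeAut n} {σ : Equiv.Perm (Fin n)} {f : Fin n → TreeAut n}
    (H : ∀ x w, g • (x :: w) = σ x :: f x • w) : root g = σ ∧ ∀ x, sec g x = f x := by
  have H' : ∀ x w, root g x = σ x ∧ sec g x • w = f x • w := fun x w => by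
    have := H x w
    rw [smul_cons] at this
    simpa using this
  exact ⟨Equiv.ext fun x => (H' x []).1, fun x => ext_smul fun w => (H' x w).2⟩

theorem ext_root_sec {g h : TreeAut n} (hr : root g = root h) (hs : ∀ x, sec g x = sec h x) :
    g = h := by
  refine ext_smul fun u => ?_
  rcases u with _ | ⟨x, w⟩
  · rw [smul_nil, smul_nil]
  · rw [smul_cons, smul_cons, hr, hs]

theorem root_sec_mul (g h : TreeAut n) : root (g * h) = root g * root h ∧
    ∀ x, sec (g * h) x = sec g (root h x) * sec h x :=
  root_sec_unique fun x w => by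
    rw [mul_smul, smul_cons h, smul_cons g, mul_smul, Equiv.Perm.mul_apply]

theorem root_sec_one : root (1 : TreeAut n) = 1 ∧ ∀ x, sec (1 : TreeAut n) x = 1 :=
  root_sec_unique (f := fun _ => 1) fun x w => by simp

@[simp] theorem root_mul (g h : TreeAut n) : root (g * h) = root g * root h := (root_sec_mul g h).1

theorem sec_mul (g h : TreeAut n) (x : Fin n) : sec (g * h) x = sec g (root h x) * sec h x :=
  (root_sec_mul g h).2 x

@[simp] theorem root_one : root (1 : TreeAut n) = 1 := root_sec_one.1

@[simp] theorem sec_one (x : Fin n) : sec (1 : TreeAut n) x = 1 := root_sec_one.2 x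

/-- The action on the first letter, as a homomorphism. -/
noncomputable def rootHom (n : ℕ) : TreeAut n →* Equiv.Perm (Fin n) where
  toFun := root
  map_one' := root_one
  map_mul' := root_mul

theorem rootHom_apply (g : TreeAut n) : rootHom n g = root g := rfl

@[simp] theorem root_inv (g : TreeAut n) : root g⁻¹ = (root g)⁻¹ := map_inv (rootHom n) g

theorem sec_inv (g : TreeAut n) (x : Fin n) : sec g⁻¹ x = (sec g ((root g)⁻¹ x))⁻¹ := by
  have h := sec_mul g g⁻¹ x
  rw [mul_inv_cancel, sec_one, root_inv] at h
  exact eq_inv_of_mul_eq_one_right h.symm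

theorem sec_inv_root (g : TreeAut n) (x : Fin n) : sec g⁻¹ (root g x) = (sec g x)⁻¹ := by
  rw [sec_inv]
  simp

/-- Evaluating at `root g x` rather than at `x` keeps inverse permutations out of the formula. -/
theorem sec_conj (g h : TreeAut n) (x : Fin n) : sec (g * h * g⁻¹) (root g x) =
    sec g (root h x) * sec h x * (sec g x)⁻¹ := by
  rw [sec_mul, sec_mul, sec_inv_root]
  simp

theorem wreath_concat (f : Fin n → TreeAut n) (σ : Fin n → Fin n)
    (F : List (Fin n) → List (Fin n)) (h0 : F [] = []) (hF : ∀ x w, F (x :: w) = σ x :: f x • w)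
    (u : List (Fin n)) (y : Fin n) : ∃ z, F (u ++ [y]) = F u ++ [z] := by
  rcases u with _ | ⟨x, u⟩
  · exact ⟨σ y, by simp [h0, hF, smul_nil]⟩
  · obtain ⟨z, hz⟩ := exists_smul_concat (f x) u y
    exact ⟨z, by simp [hF, hz]⟩

/-- The underlying map of `wreath f σ`. -/
def wreathFun (f : Fin n → TreeAut n) (σ : Fin n → Fin n) : List (Fin n) → List (Fin n)
  | [] => []
  | x :: w => σ x :: f x • w

/-- The automorphism with prescribed action `σ` on the first letter and prescribed states `f`. -/
def wreath (f : Fin n → TreeAut n) (σ : Equiv.Perm (Fin n)) : TreeAut n :=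
  ofPerm
    { toFun := wreathFun f σ
      invFun := wreathFun (fun x => (f (σ.symm x))⁻¹) σ.symm
      left_inv := by rintro (_ | ⟨x, w⟩) <;> simp [wreathFun]
      right_inv := by rintro (_ | ⟨x, w⟩) <;> simp [wreathFun] }
    rfl (wreath_concat f σ _ rfl fun _ _ => rfl)
    (wreath_concat (fun x => (f (σ.symm x))⁻¹) σ.symm _ rfl fun _ _ => rfl)

theorem root_sec_wreath (f : Fin n → TreeAut n) (σ : Equiv.Perm (Fin n)) :
    root (wreath f σ) = σ ∧ ∀ x, sec (wreath f σ) x = f x :=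
  root_sec_unique fun _ _ => rfl

@[simp] theorem root_wreath (f : Fin n → TreeAut n) (σ : Equiv.Perm (Fin n)) :
    root (wreath f σ) = σ := (root_sec_wreath f σ).1

@[simp] theorem sec_wreath (f : Fin n → TreeAut n) (σ : Equiv.Perm (Fin n)) (x : Fin n) :
    sec (wreath f σ) x = f x := (root_sec_wreath f σ).2 x

/-- The embedding of `Aut(T) ^ n` as the stabilizer of the first level. -/
def wreathHom (n : ℕ) : (Fin n → TreeAut n) →* TreeAut n where
  toFun f := wreath f 1
  map_one' := ext_root_sec (by simp) (by simp)
  map_mul' f g := ext_root_sec (by simp) (by simp [sec_mul])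

@[simp] theorem root_wreathHom (f : Fin n → TreeAut n) : root (wreathHom n f) = 1 :=
  root_wreath f 1

@[simp] theorem sec_wreathHom (f : Fin n → TreeAut n) (x : Fin n) : sec (wreathHom n f) x = f x :=
  sec_wreath f 1 x

/-- The embedding of `Aut(T)` as the automorphisms supported below the letter `x`. -/
noncomputable def single (x : Fin n) : TreeAut n →* TreeAut n :=
  (wreathHom n).comp (MonoidHom.mulSingle (fun _ => TreeAut n) x)

@[simp] theorem root_single (x : Fin n) (g : TreeAut n) : root (single x g) = 1 :=
  root_wreath _ 1

theorem sec_single (x : Fin n) (g : TreeAut n) (y : Fin n) :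
    sec (single x g) y = Pi.mulSingle (M := fun _ => TreeAut n) x g y := sec_wreath _ 1 y

@[simp] theorem sec_single_same (x : Fin n) (g : TreeAut n) : sec (single x g) x = g := by
  simp [sec_single]

@[simp] theorem sec_single_of_ne {x y : Fin n} (h : y ≠ x) (g : TreeAut n) :
    sec (single x g) y = 1 := by
  simp [sec_single, Pi.mulSingle_eq_of_ne h]

theorem eq_single_of_sec {x : Fin n} {h : TreeAut n} (hr : root h = 1)
    (hs : ∀ y, y ≠ x → sec h y = 1) : h = single x (sec h x) := by
  refine ext_root_sec (by simp [hr]) fun y => ?_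
  rcases eq_or_ne y x with rfl | hy
  · simp
  · rw [sec_single_of_ne hy, hs y hy]

theorem mem_levelStab_succ [NeZero n] {m : ℕ} {g : TreeAut n} :
    g ∈ levelStab n (m + 1) ↔ root g = 1 ∧ ∀ x, sec g x ∈ levelStab n m := by
  simp only [mem_levelStab]
  constructor
  · intro H
    have H' : ∀ (x : Fin n) (w : List (Fin n)), w.length = m → root g x = x ∧ sec g x • w = w := fun x w hw => by
      have := H (x :: w) (by simp [hw])
      rw [smul_cons] at this
      simpa using this
    exact ⟨Equiv.ext fun x => (H' x (List.replicate m 0) (by simp)).1,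
      fun x w hw => (H' x w hw).2⟩
  · rintro ⟨hr, hs⟩ u hu
    rcases u with _ | ⟨x, w⟩
    · simp at hu
    · rw [smul_cons, hr, hs x w (by simpa using hu), Equiv.Perm.one_apply]

theorem mem_levelStab_one [NeZero n] {g : TreeAut n} : g ∈ levelStab n 1 ↔ root g = 1 := by
  rw [mem_levelStab_succ, levelStab_zero]
  simp

theorem ker_rootHom [NeZero n] : (rootHom n).ker = levelStab n 1 := by
  ext g
  rw [mem_levelStab_one, MonoidHom.mem_ker, rootHom_apply]

/-- The states at the letters, as a homomorphism on the stabilizer of the first level. -/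
noncomputable def secHom (n : ℕ) : (rootHom n).ker →* (Fin n → TreeAut n) where
  toFun g x := sec g.1 x
  map_one' := by ext; simp
  map_mul' g h := by
    ext x : 1
    have : root h.1 = 1 := h.2
    simp [sec_mul, this]

end TreeAut

/-! ### Topology of Aut(T) and Hausdorff dimension of closed subgroups -/

namespace TreeAut

variable {n : ℕ}

theorem inv_mul_mem_levelStab_of_dist_lt {g h : TreeAut n} {m : ℕ}
    (H : dist g h < ((levelStab n m).index : ℝ)⁻¹) : g⁻¹ * h ∈ levelStab n m := by
  by_contra hm
  exact absurd (le_levelDist hm) (not_le.2 H)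

theorem inv_mul_mem_levelStab {g h : TreeAut n} {m : ℕ} :
    g⁻¹ * h ∈ levelStab n m ↔ ∀ u : List (Fin n), u.length = m → h • u = g • u := by
  rw [mem_levelStab]
  refine forall₂_congr fun u _ => ?_
  rw [mul_smul, inv_smul_eq_iff]

/-- Sharper by one level than `le_levelDist`: the levels that enter the infimum are all at most `m`.
This is what makes the diameter of a set comparable to the last level that does not separate it. -/
theorem inv_index_le_dist {g h : TreeAut n} {m : ℕ} (H : g⁻¹ * h ∉ levelStab n (m + 1)) :
    ((levelStab n m).index : ℝ)⁻¹ ≤ dist g h := by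
  have hgh : g ≠ h := by
    rintro rfl
    exact H (by rw [inv_mul_cancel]; exact one_mem _)
  have := nonempty_levels g h
  rw [dist_eq_levelDist, levelDist_of_ne hgh]
  refine le_ciInf fun a => inv_anti₀ (index_pos _) (index_mono ?_)
  by_contra! hlt
  exact H (levelStab_antitone hlt a.2)

theorem isOpen_levelStab (m : ℕ) : IsOpen (levelStab n m : Set (TreeAut n)) := by
  rw [Metric.isOpen_iff]
  intro g hg
  refine ⟨_, inv_pos.2 (index_pos (n := n) m), fun h hh => ?_⟩
  have : g⁻¹ * h ∈ levelStab n m := inv_mul_mem_levelStab_of_dist_lt (by rwa [dist_comm])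
  simpa using mul_mem (show g ∈ levelStab n m from hg) this

/-- A point of the closure is congruent to an element of `H` modulo each level stabilizer, because a
small ball lies in one coset of it. -/
theorem relIndex_topologicalClosure (H : Subgroup (TreeAut n)) (m : ℕ) :
    (levelStab n m).relIndex H.topologicalClosure = (levelStab n m).relIndex H := by
  have key : H.topologicalClosure.map (QuotientGroup.mk' (levelStab n m)) =
      H.map (QuotientGroup.mk' (levelStab n m)) := by
    refine le_antisymm ?_ (Subgroup.map_mono H.le_topologicalClosure)
    rintro _ ⟨g, hg, rfl⟩
    have hg' : g ∈ closure (H : Set (TreeAut n)) := hg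
    obtain ⟨h, hh, hd⟩ := Metric.mem_closure_iff.1 hg' _ (inv_pos.2 (index_pos m))
    exact ⟨h, hh, (QuotientGroup.eq.2 (inv_mul_mem_levelStab_of_dist_lt hd)).symm⟩
  rw [← QuotientGroup.ker_mk' (levelStab n m), Subgroup.relIndex_ker, Subgroup.relIndex_ker, key]

/-- On each level a Cauchy sequence is eventually constant; the limit is defined level by level from
these eventual values. -/
theorem exists_tendsto_of_cauchySeq
    (hidx : Filter.Tendsto (fun m => ((levelStab n m).index : ℝ)) Filter.atTop Filter.atTop)
    {g : ℕ → TreeAut n} (hg : CauchySeq g) : ∃ a, Filter.Tendsto g Filter.atTop (nhds a) := by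
  have hN : ∀ m, ∃ N, ∀ k, N ≤ k → ∀ u : List (Fin n), u.length = m → g k • u = g N • u := by
    intro m
    obtain ⟨N, hN⟩ := Metric.cauchySeq_iff'.1 hg _ (inv_pos.2 (index_pos m))
    refine ⟨N, fun k hk => inv_mul_mem_levelStab.1 (inv_mul_mem_levelStab_of_dist_lt ?_)⟩
    rw [dist_comm]
    exact hN k hk
  choose N hN using hN
  have hN' : ∀ m k, N m ≤ k → ∀ u : List (Fin n), u.length = m →
      (g k)⁻¹ • u = (g (N m))⁻¹ • u := by
    intro m k hk u hu
    have := hN m k hk ((g (N m))⁻¹ • u) (by rw [length_smul, hu])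
    rw [smul_inv_smul] at this
    rw [inv_smul_eq_iff, this]
  let f : Equiv.Perm (List (Fin n)) :=
    { toFun := fun u => g (N u.length) • u
      invFun := fun u => (g (N u.length))⁻¹ • u
      left_inv := fun u => by simp [length_smul]
      right_inv := fun u => by simp [length_smul] }
  let a : TreeAut n := ofPerm f (smul_nil _)
    (fun u x => by
      -- The limit uses different members of the sequence on the levels of `u` and of `u ++ [x]`; at
      -- the maximum of the two indices a single automorphism agrees with both.
      obtain ⟨y, hy⟩ := exists_smul_concat
        (g (max (N u.length) (N (u ++ [x]).length))) u x
      refine ⟨y, ?_⟩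
      rw [hN _ _ (le_max_left _ _) u rfl, hN _ _ (le_max_right _ _) (u ++ [x]) rfl] at hy
      exact hy)
    (fun u x => by
      obtain ⟨y, hy⟩ := exists_smul_concat
        (g (max (N u.length) (N (u ++ [x]).length)))⁻¹ u x
      refine ⟨y, ?_⟩
      rw [hN' _ _ (le_max_left _ _) u rfl, hN' _ _ (le_max_right _ _) (u ++ [x]) rfl] at hy
      exact hy)
  refine ⟨a, Metric.tendsto_atTop.2 fun ε hε => ?_⟩
  obtain ⟨m, hm⟩ := ((tendsto_inv_atTop_zero.comp hidx).eventually (gt_mem_nhds hε)).exists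
  refine ⟨N m, fun k hk => lt_of_le_of_lt (levelDist_le ?_) hm⟩
  rw [inv_mul_mem_levelStab]
  intro u hu
  rw [hN m k hk u hu, ← hu]
  rfl

/-- Completeness comes from level-wise limits, total boundedness from the finiteness of the
quotients by level stabilizers. -/
theorem compactSpace
    (hidx : Filter.Tendsto (fun m => ((levelStab n m).index : ℝ)) Filter.atTop Filter.atTop) :
    CompactSpace (TreeAut n) := by
  have : CompleteSpace (TreeAut n) :=
    Metric.complete_of_cauchySeq_tendsto fun _ => exists_tendsto_of_cauchySeq hidx
  refine ⟨isCompact_iff_totallyBounded_isComplete.2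
    ⟨Metric.totallyBounded_iff.2 fun ε hε => ?_, completeSpace_iff_isComplete_univ.1 this⟩⟩
  obtain ⟨m, hm⟩ := ((tendsto_inv_atTop_zero.comp hidx).eventually (gt_mem_nhds hε)).exists
  have : Finite (TreeAut n ⧸ levelStab n m) := Subgroup.finite_quotient_of_finiteIndex
  refine ⟨Set.range (Quotient.out : TreeAut n ⧸ levelStab n m → TreeAut n), Set.finite_range _,
    fun g _ => Set.mem_iUnion₂.2 ⟨_, ⟨(g : TreeAut n ⧸ levelStab n m), rfl⟩, ?_⟩⟩
  rw [Metric.mem_ball]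
  refine lt_of_le_of_lt (levelDist_le ?_) hm
  rw [← QuotientGroup.eq]
  exact (QuotientGroup.out_eq' _).symm

section Dimension

open MeasureTheory Measure Filter

variable {K : Subgroup (TreeAut n)} {d : ℝ}

/-- At level `m` the group is covered by |K : Stab_K(m)| cosets of diameter at most 1/|Aut(T) :
Stab(m)|. For exponent `d + ε` the sum of the powers of the diameters is eventually at most 1, so
that Hausdorff measure is finite. -/
theorem dimH_le_of_tendsto
    (hidx : Tendsto (fun m => ((levelStab n m).index : ℝ)) atTop atTop) (hd : 0 ≤ d)
    (hlim : Tendsto (fun m => Real.log ((levelStab n m).relIndex K : ℝ) /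
      Real.log ((levelStab n m).index : ℝ)) atTop (nhds d)) :
    dimH (K : Set (TreeAut n)) ≤ ENNReal.ofReal d := by
  borelize (TreeAut n)
  refine ENNReal.le_of_forall_pos_le_add fun ε hε _ => ?_
  have hds : d < d + ε := by simpa using hε
  rw [ENNReal.ofReal, ← ENNReal.coe_add]
  refine dimH_le_of_hausdorffMeasure_ne_top (ne_top_of_le_ne_top ENNReal.one_ne_top ?_)
  have hs : ((d.toNNReal + ε : NNReal) : ℝ) = d + ε := by simp [hd]
  rw [hs]
  have hfin : ∀ m, Finite (K ⧸ (levelStab n m).subgroupOf K) := fun m =>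
    Subgroup.finite_quotient_of_finiteIndex
  let _ : ∀ m, Fintype (K ⧸ (levelStab n m).subgroupOf K) := fun m => Fintype.ofFinite _
  let t : ∀ m, K ⧸ (levelStab n m).subgroupOf K → Set (TreeAut n) := fun m q =>
    Subtype.val '' {k : K | (k : K ⧸ (levelStab n m).subgroupOf K) = q}
  have ht : ∀ m q, Metric.ediam (t m q) ≤ ENNReal.ofReal ((levelStab n m).index : ℝ)⁻¹ := by
    intro m q
    refine Metric.ediam_le ?_
    rintro _ ⟨k, hk, rfl⟩ _ ⟨l, hl, rfl⟩
    rw [edist_dist]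
    refine ENNReal.ofReal_le_ofReal (levelDist_le ?_)
    have := QuotientGroup.eq.1 ((show _ = q from hk).trans (show _ = q from hl).symm)
    simpa [Subgroup.mem_subgroupOf] using this
  have hr : Tendsto (fun m => ENNReal.ofReal ((levelStab n m).index : ℝ)⁻¹) atTop (nhds 0) := by
    simpa using ENNReal.tendsto_ofReal (tendsto_inv_atTop_zero.comp hidx)
  refine (hausdorffMeasure_le_liminf_sum (d + ε) (K : Set (TreeAut n)) _ hr t
    (Eventually.of_forall ht) (Eventually.of_forall fun m k hk =>
      Set.mem_iUnion.2 ⟨_, ⟨⟨k, hk⟩, rfl, rfl⟩⟩)).trans ?_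
  refine liminf_le_of_frequently_le' (Eventually.frequently ?_)
  filter_upwards [hlim.eventually (gt_mem_nhds hds), hidx.eventually (eventually_gt_atTop 1)]
    with m hm hm1
  have hi := index_pos (n := n) m
  have hrel : (0 : ℝ) < (levelStab n m).relIndex K := by
    exact_mod_cast Nat.pos_of_ne_zero (Subgroup.FiniteIndex.index_ne_zero
      (H := (levelStab n m).subgroupOf K))
  have hcard : ((levelStab n m).relIndex K : ℝ) ≤ ((levelStab n m).index : ℝ) ^ (d + ε) := by
    rw [← Real.log_le_log_iff hrel (Real.rpow_pos_of_pos hi _), Real.log_rpow hi]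
    exact ((div_lt_iff₀ (Real.log_pos hm1)).1 hm).le
  calc ∑ q, Metric.ediam (t m q) ^ (d + ε)
      ≤ ∑ q : K ⧸ (levelStab n m).subgroupOf K,
          (ENNReal.ofReal ((levelStab n m).index : ℝ)⁻¹) ^ (d + ε) :=
        Finset.sum_le_sum fun q _ => ENNReal.rpow_le_rpow (ht m q) (by positivity)
    _ = ((levelStab n m).relIndex K : ℝ≥0∞) *
          (ENNReal.ofReal ((levelStab n m).index : ℝ)⁻¹) ^ (d + ε) := by
        rw [Finset.sum_const, nsmul_eq_mul, Finset.card_univ, ← Nat.card_eq_fintype_card]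
        rfl
    _ = ENNReal.ofReal ((levelStab n m).relIndex K *
          (((levelStab n m).index : ℝ)⁻¹) ^ (d + ε)) := by
        rw [ENNReal.ofReal_mul hrel.le, ENNReal.ofReal_natCast,
          ENNReal.ofReal_rpow_of_pos (inv_pos.2 hi)]
    _ ≤ 1 := by
        rw [ENNReal.ofReal_le_one, Real.inv_rpow hi.le]
        exact mul_inv_le_one_of_le₀ hcard (by positivity)

/-- The mass distribution bound. If `M` is the last level at which `U` lies in a single coset, then
μ(U) ≤ 1/|K : Stab_K(M)|, while two points of `U` separated at level `M + 1` force the diameter to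
be at least 1/|Aut(T) : Stab(M)|. -/
theorem measure_le_of_ediam_le [MeasurableSpace K] [BorelSpace K] (μ : Measure K) [μ.IsMulLeftInvariant]
    (hμ : μ Set.univ = 1) {s : ℝ} (hs : 0 < s) {m₀ : ℕ}
    (hrel : ∀ m, m₀ ≤ m →
      ((levelStab n m).index : ℝ) ^ s ≤ (levelStab n m).relIndex K)
    (hidx : Tendsto (fun m => ((levelStab n m).index : ℝ)) atTop atTop)
    (U : Set K) (hU : Metric.ediam U < ENNReal.ofReal ((levelStab n m₀).index : ℝ)⁻¹) :
    μ U ≤ Metric.ediam U ^ s := by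
  have hL : ∀ m, m₀ ≤ m → ∀ g ∈ U, (∀ h ∈ U, (g : TreeAut n)⁻¹ * h ∈ levelStab n m) →
      μ U ≤ ENNReal.ofReal (((levelStab n m).index : ℝ)⁻¹) ^ s := by
    intro m hm g hg H
    have hi := index_pos (n := n) m
    have hmeas : MeasurableSet ((levelStab n m).subgroupOf K : Set K) :=
      ((isOpen_levelStab m).preimage continuous_subtype_val).measurableSet
    have h1 := Subgroup.index_mul_measure _ hmeas μ
    have hsub : U ⊆ (fun k => g⁻¹ * k) ⁻¹' ((levelStab n m).subgroupOf K : Set K) :=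
      fun h hh => H h hh
    refine (measure_mono hsub).trans ?_
    rw [measure_preimage_mul]
    have hr : (0 : ℝ) < (levelStab n m).relIndex K :=
      lt_of_lt_of_le (Real.rpow_pos_of_pos hi s) (hrel m hm)
    rw [hμ] at h1
    have h2 : μ ((levelStab n m).subgroupOf K : Set K) =
        ENNReal.ofReal (((levelStab n m).relIndex K : ℝ)⁻¹) := by
      rw [ENNReal.ofReal_inv_of_pos hr, ENNReal.ofReal_natCast]
      refine ENNReal.eq_inv_of_mul_eq_one_left ?_
      rw [mul_comm]
      exact h1
    rw [h2, ENNReal.ofReal_rpow_of_pos (inv_pos.2 hi)]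
    refine ENNReal.ofReal_le_ofReal ?_
    rw [Real.inv_rpow hi.le]
    exact inv_anti₀ (Real.rpow_pos_of_pos hi s) (hrel m hm)
  rcases U.eq_empty_or_nonempty with rfl | ⟨g, hg⟩
  · simp
  by_cases hsub : U.Subsingleton
  -- A single point lies in one coset at every level, so its measure is bounded by a sequence
  -- tending to zero.
  · have hz : ∀ m, m₀ ≤ m → μ U ≤ ENNReal.ofReal (((levelStab n m).index : ℝ)⁻¹) ^ s :=
      fun m hm => hL m hm g hg fun h hh => by
        rw [hsub hh hg, inv_mul_cancel]
        exact one_mem _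
    have ht : Tendsto (fun m => ENNReal.ofReal (((levelStab n m).index : ℝ)⁻¹) ^ s) atTop
        (nhds 0) := by
      have h1 : Tendsto (fun m => ENNReal.ofReal ((levelStab n m).index : ℝ)⁻¹) atTop (nhds 0) := by
        simpa using ENNReal.tendsto_ofReal (tendsto_inv_atTop_zero.comp hidx)
      have h2 := (ENNReal.continuous_rpow_const (y := s)).tendsto 0
      rw [ENNReal.zero_rpow_of_pos hs] at h2
      exact h2.comp h1
    have : μ U ≤ 0 := ge_of_tendsto ht ((eventually_ge_atTop m₀).mono hz)
    exact this.trans zero_le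
  have hex : ∃ M, ∃ g ∈ U, ∃ h ∈ U, (g : TreeAut n)⁻¹ * h ∉ levelStab n M := by
    by_contra! H
    exact hsub fun g hg h hh => Subtype.ext (eq_of_forall_mem_levelStab fun m => H m g hg h hh)
  classical
  obtain ⟨M, hM⟩ : ∃ M, Nat.find hex = M + 1 := by
    refine Nat.exists_eq_succ_of_ne_zero fun h0 => ?_
    obtain ⟨g, _, h, _, hgh⟩ := Nat.find_spec hex
    rw [h0, levelStab_zero] at hgh
    exact hgh trivial
  have hmem : ∀ g ∈ U, ∀ h ∈ U, (g : TreeAut n)⁻¹ * h ∈ levelStab n M := by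
    by_contra! H
    obtain ⟨g, hg, h, hh, hgh⟩ := H
    exact Nat.find_min hex (by omega) ⟨g, hg, h, hh, hgh⟩
  have hdiam : ENNReal.ofReal (((levelStab n M).index : ℝ)⁻¹) ≤ Metric.ediam U := by
    obtain ⟨g, hg, h, hh, hgh⟩ := Nat.find_spec hex
    rw [hM] at hgh
    refine le_trans ?_ (Metric.edist_le_ediam_of_mem hg hh)
    rw [edist_dist]
    exact ENNReal.ofReal_le_ofReal (inv_index_le_dist hgh)
  -- The smallness of `U` enters here: it forces `M` into the range where the growth estimate holds.
  have hm : m₀ ≤ M := by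
    by_contra! hlt
    have := lt_of_le_of_lt hdiam hU
    rw [ENNReal.ofReal_lt_ofReal_iff (inv_pos.2 (index_pos _))] at this
    exact absurd (inv_anti₀ (index_pos _) (index_mono hlt.le)) (not_le.2 this)
  exact (hL M hm g hg (hmem g hg)).trans (ENNReal.rpow_le_rpow hdiam hs.le)

theorem le_dimH_of_tendsto (hK : IsClosed (K : Set (TreeAut n)))
    (hidx : Tendsto (fun m => ((levelStab n m).index : ℝ)) atTop atTop)
    (hlim : Tendsto (fun m => Real.log ((levelStab n m).relIndex K : ℝ) /
      Real.log ((levelStab n m).index : ℝ)) atTop (nhds d)) :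
    ENNReal.ofReal d ≤ dimH (K : Set (TreeAut n)) := by
  have := compactSpace hidx
  have : CompactSpace K := isCompact_iff_compactSpace.1 hK.isCompact
  borelize (↥K)
  have himg : dimH (K : Set (TreeAut n)) = dimH (Set.univ : Set K) := by
    have h := Isometry.dimH_image (f := (Subtype.val : K → TreeAut n)) isometry_subtype_coe
      Set.univ
    rw [← h, Set.image_univ, Subtype.range_coe]
  rw [himg]
  refine le_of_forall_lt fun c hc => ?_
  obtain ⟨s, hcs, hsd⟩ := ENNReal.lt_iff_exists_nnreal_btwn.1 hc
  refine hcs.trans_le ?_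
  have hs0 : (0 : ℝ) < s := by
    have : (0 : ℝ≥0∞) < s := lt_of_le_of_lt zero_le hcs
    exact_mod_cast this
  have hsd' : (s : ℝ) < d := by
    rw [ENNReal.ofReal, ENNReal.coe_lt_coe] at hsd
    exact Real.lt_toNNReal_iff_coe_lt.1 hsd
  obtain ⟨m₀, hm₀⟩ := eventually_atTop.1 ((hlim.eventually (lt_mem_nhds hsd')).and
    (hidx.eventually (eventually_gt_atTop 1)))
  have hrel : ∀ m, m₀ ≤ m →
      ((levelStab n m).index : ℝ) ^ (s : ℝ) ≤ (levelStab n m).relIndex K := by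
    intro m hm
    obtain ⟨h1, h2⟩ := hm₀ m hm
    have hr : (0 : ℝ) < (levelStab n m).relIndex K := by
      exact_mod_cast Nat.pos_of_ne_zero (Subgroup.FiniteIndex.index_ne_zero
        (H := (levelStab n m).subgroupOf K))
    rw [← Real.log_le_log_iff (Real.rpow_pos_of_pos (index_pos _) _) hr,
      Real.log_rpow (index_pos _)]
    exact ((lt_div_iff₀ (Real.log_pos h2)).1 h1).le
  -- Since `K` is compact, the whole group serves as the reference compact set and the Haar measure
  -- is a probability measure.
  let μ : Measure K := haarMeasure ⊤
  have hμ : μ Set.univ = 1 := by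
    have := haarMeasure_self (K₀ := (⊤ : TopologicalSpace.PositiveCompacts K))
    simpa using this
  have hi := inv_pos.2 (index_pos (n := n) m₀)
  have hle : μ ≤ μH[(s : ℝ)] := by
    -- The factor 1/2 turns the non-strict bound on the diameter into the strict one required by
    -- `measure_le_of_ediam_le`.
    refine le_hausdorffMeasure _ _ (ENNReal.ofReal ((levelStab n m₀).index : ℝ)⁻¹ / 2) ?_ ?_
    · simpa using (levelStab_finiteIndex (n := n) m₀).index_ne_zero
    · intro U hU
      refine measure_le_of_ediam_le μ hμ hs0 hrel hidx U (lt_of_le_of_lt hU ?_)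
      exact ENNReal.half_lt_self (by simpa using (levelStab_finiteIndex (n := n) m₀).index_ne_zero) ENNReal.ofReal_ne_top
  refine le_dimH_of_hausdorffMeasure_ne_zero fun h0 => ?_
  have := hle Set.univ
  rw [h0, hμ] at this
  simp at this

theorem dimH_eq_of_tendsto (hK : IsClosed (K : Set (TreeAut n)))
    (hidx : Tendsto (fun m => ((levelStab n m).index : ℝ)) atTop atTop) (hd : 0 ≤ d)
    (hlim : Tendsto (fun m => Real.log ((levelStab n m).relIndex K : ℝ) /
      Real.log ((levelStab n m).index : ℝ)) atTop (nhds d)) :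
    dimH (K : Set (TreeAut n)) = ENNReal.ofReal d :=
  le_antisymm (dimH_le_of_tendsto hidx hd hlim) (le_dimH_of_tendsto hK hidx hlim)

end Dimension

end TreeAut

/-! ### Orders of the level quotients, and branching subgroups -/

namespace TreeAut

variable {n : ℕ}

theorem relIndex_levelStab_succ (G : Subgroup (TreeAut n)) (m : ℕ) :
    (levelStab n (m + 1)).relIndex G =
      (levelStab n (m + 1)).relIndex (levelStab n m ⊓ G) * (levelStab n m).relIndex G := by
  rw [Subgroup.relIndex_inf_mul_relIndex, inf_eq_left.2 (levelStab_antitone (Nat.le_succ m))]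

theorem relIndex_levelStab_one [NeZero n] (G : Subgroup (TreeAut n)) :
    (levelStab n 1).relIndex G = Nat.card (G.map (rootHom n)) := by
  rw [← ker_rootHom, Subgroup.relIndex_ker]

/-- The stabilizer of level `m + 1` in terms of a homomorphism with kernel the stabilizer of level
`m`. -/
theorem relIndex_eq_card_map [NeZero n] {M : Type*} [Group M] (π : TreeAut n →* M) {m : ℕ}
    (hπ : π.ker = levelStab n m) {K : Subgroup (TreeAut n)} (hK : K ≤ levelStab n 1)
    (N : Subgroup (Fin n → M))
    (hN : ∀ f, f ∈ N ↔ ∃ g ∈ K, ∀ x, π (sec g x) = f x) :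
    (levelStab n (m + 1)).relIndex K = Nat.card N := by
  rw [← ker_rootHom] at hK
  let ψ : (rootHom n).ker →* (Fin n → M) := (π.compLeft (Fin n)).comp (secHom n)
  have hψ : ψ.ker = (levelStab n (m + 1)).subgroupOf (rootHom n).ker := by
    ext g
    have hg : root g.1 = 1 := g.2
    rw [Subgroup.mem_subgroupOf, mem_levelStab_succ, MonoidHom.mem_ker, funext_iff]
    simp only [hg, true_and, ← hπ, MonoidHom.mem_ker]
    rfl
  rw [← Subgroup.relIndex_subgroupOf hK, ← hψ, Subgroup.relIndex_ker]
  congr 2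
  ext f
  rw [hN, Subgroup.mem_map]
  constructor
  · rintro ⟨g, hg, rfl⟩
    exact ⟨g.1, hg, fun x => rfl⟩
  · rintro ⟨g, hg, hf⟩
    exact ⟨⟨g, hK hg⟩, hg, funext hf⟩

theorem card_subgroup_pi {M : Type*} [Group M] (J : Subgroup M) :
    Nat.card (Subgroup.pi Set.univ fun _ : Fin n => J) = Nat.card J ^ n := by
  have h := Nat.card_congr (Equiv.Set.univPi fun _ : Fin n => (J : Set M))
  rw [Nat.card_pi, Finset.prod_const, Finset.card_univ, Fintype.card_fin] at h
  exact h

/-- Modulo level `m` the tuples of states of `K` fill the whole power of the image of `J`: `h₁`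
keeps them inside, `h₂` realises every tuple. -/
theorem relIndex_eq_pow [NeZero n] {m : ℕ} {J K : Subgroup (TreeAut n)} (hK : K ≤ levelStab n 1)
    (h₁ : ∀ g ∈ K, ∀ x, sec g x ∈ J)
    (h₂ : ∀ f : Fin n → TreeAut n, (∀ x, f x ∈ J) →
      ∃ h ∈ K, ∀ x, (sec h x)⁻¹ * f x ∈ levelStab n m) :
    (levelStab n (m + 1)).relIndex K = (levelStab n m).relIndex J ^ n := by
  have h3 := Subgroup.relIndex_ker J (QuotientGroup.mk' (levelStab n m))
  rw [QuotientGroup.ker_mk'] at h3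
  rw [relIndex_eq_card_map (QuotientGroup.mk' (levelStab n m)) (QuotientGroup.ker_mk' _) hK
    (Subgroup.pi Set.univ fun _ => J.map (QuotientGroup.mk' (levelStab n m))), card_subgroup_pi, h3]
  intro f
  rw [Subgroup.mem_pi]
  constructor
  · intro hf
    choose f' hf' hff' using fun x => hf x (Set.mem_univ x)
    obtain ⟨h, hh, hs⟩ := h₂ f' hf'
    exact ⟨h, hh, fun x => (QuotientGroup.eq.2 (hs x)).trans (hff' x)⟩
  · rintro ⟨g, hg, hf⟩ x _
    exact ⟨sec g x, h₁ g hg x, hf x⟩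

theorem levelStab_succ_le_one (m : ℕ) : levelStab n (m + 1) ≤ levelStab n 1 :=
  levelStab_antitone (Nat.le_add_left 1 m)

theorem relIndex_levelStab [NeZero n] (m : ℕ) :
    (levelStab n (m + 1)).relIndex (levelStab n m) = n.factorial ^ n ^ m := by
  induction m with
  | zero =>
    have : (⊤ : Subgroup (TreeAut n)).map (rootHom n) = ⊤ := by
      rw [eq_top_iff]
      exact fun σ _ => ⟨wreath 1 σ, trivial, root_wreath _ _⟩
    rw [levelStab_zero, zero_add, relIndex_levelStab_one, this, Subgroup.card_top, Nat.card_perm]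
    simp
  | succ m ih =>
    rw [relIndex_eq_pow (J := levelStab n m) (levelStab_succ_le_one m), ih, ← pow_mul, pow_succ]
    · exact fun g hg => (mem_levelStab_succ.1 hg).2
    · exact fun f hf => ⟨wreath f 1, mem_levelStab_succ.2 ⟨by simp, by simpa using hf⟩,
        fun x => by simp [one_mem]⟩

theorem index_levelStab [NeZero n] (m : ℕ) :
    (levelStab n m).index = n.factorial ^ ∑ i ∈ Finset.range m, n ^ i := by
  induction m with
  | zero => simp [levelStab_zero]
  | succ m ih =>
    rw [← Subgroup.relIndex_mul_index (levelStab_antitone (Nat.le_succ m)), ih,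
      Nat.succ_eq_add_one, relIndex_levelStab, Finset.sum_range_succ, pow_add, mul_comm]

/-- `B` is a subgroup of the self-similar group `G` which contains its own copies below the letters
and has the same action as `G` on the second level inside the stabilizer of the first level. -/
structure IsBranching (G B : Subgroup (TreeAut n)) : Prop where
  le : B ≤ G
  sec_mem : ∀ g ∈ G, ∀ x, sec g x ∈ G
  single_mem : ∀ x, ∀ b ∈ B, single x b ∈ B
  exists_root_sec : ∀ g ∈ G, root g = 1 →
    ∃ b ∈ B, root b = 1 ∧ ∀ x, root (sec b x) = root (sec g x)

theorem wreathHom_mem {B : Subgroup (TreeAut n)} (hB : ∀ x, ∀ b ∈ B, single x b ∈ B)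
    {f : Fin n → TreeAut n} (hf : ∀ x, f x ∈ B) : wreathHom n f ∈ B := by
  have : Subgroup.pi Set.univ (fun _ : Fin n => B) ≤ B.comap (wreathHom n) := by
    rw [Subgroup.pi_le_iff]
    rintro x _ ⟨b, hb, rfl⟩
    exact hB x b hb
  exact this fun x _ => hf x

namespace IsBranching

variable {G B : Subgroup (TreeAut n)}

/-- Down the tree, `B` sees as much of each layer as `G` does. The states of `g` are approximated
one level higher up, and the approximations are glued below the letters, which stays in `B`. -/
theorem exists_inv_mul_mem [NeZero n] (h : IsBranching G B) (m : ℕ) :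
    ∀ g ∈ G, g ∈ levelStab n (m + 1) →
      ∃ b ∈ B, b ∈ levelStab n (m + 1) ∧ b⁻¹ * g ∈ levelStab n (m + 2) := by
  induction m with
  | zero =>
    intro g hg hg1
    rw [zero_add, mem_levelStab_one] at hg1
    obtain ⟨b, hb, hb1, hs⟩ := h.exists_root_sec g hg hg1
    refine ⟨b, hb, mem_levelStab_one.2 hb1, mem_levelStab_succ.2 ⟨by simp [hb1, hg1], fun x => ?_⟩⟩
    rw [mem_levelStab_one, sec_mul, sec_inv]
    simp [hg1, hb1, hs]
  | succ m ih =>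
    intro g hg hgm
    obtain ⟨hg1, hgs⟩ := mem_levelStab_succ.1 hgm
    choose b hb hbm hbg using fun x => ih (sec g x) (h.sec_mem g hg x) (hgs x)
    refine ⟨wreathHom n b, wreathHom_mem h.single_mem hb, mem_levelStab_succ.2 ⟨by simp, ?_⟩,
      mem_levelStab_succ.2 ⟨by simp [hg1], fun x => ?_⟩⟩
    · simpa using hbm
    · rw [sec_mul, sec_inv]
      simpa [hg1] using hbg x

/-- Approximations taken in `B` can be chosen independently at the letters, so each layer is the
n-th power of the previous one. The recursion starts only with the layer between levels 1 and 2,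
since the root layer is not governed by `B`. -/
theorem relIndex_succ [NeZero n] (h : IsBranching G B) (m : ℕ) :
    (levelStab n (m + 3)).relIndex (levelStab n (m + 2) ⊓ G) =
      (levelStab n (m + 2)).relIndex (levelStab n (m + 1) ⊓ G) ^ n := by
  refine relIndex_eq_pow (inf_le_left.trans (levelStab_succ_le_one _)) ?_ ?_
  · rintro g ⟨hg, hG⟩ x
    exact ⟨(mem_levelStab_succ.1 hg).2 x, h.sec_mem g hG x⟩
  · intro f hf
    choose b hb hbm hbg using fun x => h.exists_inv_mul_mem m (f x) (hf x).2 (hf x).1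
    refine ⟨wreathHom n b, ⟨mem_levelStab_succ.2 ⟨by simp, by simpa using hbm⟩,
      h.le (wreathHom_mem h.single_mem hb)⟩, fun x => ?_⟩
    simpa using hbg x

theorem relIndex_eq [NeZero n] (h : IsBranching G B) (N : Subgroup (Fin n → Equiv.Perm (Fin n)))
    (hN : ∀ f, f ∈ N ↔ ∃ g ∈ G, root g = 1 ∧ ∀ x, root (sec g x) = f x) (m : ℕ) :
    (levelStab n (m + 1)).relIndex G =
      Nat.card (G.map (rootHom n)) * Nat.card N ^ ∑ i ∈ Finset.range m, n ^ i := by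
  have hq : ∀ m, (levelStab n (m + 2)).relIndex (levelStab n (m + 1) ⊓ G) =
      Nat.card N ^ n ^ m := by
    intro m
    induction m with
    | zero =>
      rw [pow_zero, pow_one]
      refine relIndex_eq_card_map (rootHom n) ker_rootHom inf_le_left N fun f => ?_
      rw [hN]
      refine exists_congr fun g => ?_
      rw [Subgroup.mem_inf, mem_levelStab_one]
      simp only [rootHom_apply]
      tauto
    | succ m ih => rw [h.relIndex_succ, ih, ← pow_mul, pow_succ]
  induction m with
  | zero => simp [relIndex_levelStab_one]
  | succ m ih =>
    rw [relIndex_levelStab_succ, hq, ih, Finset.sum_range_succ, pow_add]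
    ring

end IsBranching

/-! ### Limit of the ratio of logarithms -/

section Limit

open Filter

theorem tendsto_sum_pow (hn : 1 ≤ n) :
    Tendsto (fun m => (∑ i ∈ Finset.range m, (n : ℝ) ^ i)) atTop atTop := by
  refine tendsto_atTop_mono (fun m => ?_) tendsto_natCast_atTop_atTop
  have h1 : (1 : ℝ) ≤ n := by exact_mod_cast hn
  calc (m : ℝ) = ∑ i ∈ Finset.range m, 1 := by simp
    _ ≤ _ := Finset.sum_le_sum fun i _ => one_le_pow₀ h1

theorem log_index_levelStab [NeZero n] (m : ℕ) : Real.log ((levelStab n m).index : ℝ) =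
    (∑ i ∈ Finset.range m, (n : ℝ) ^ i) * Real.log (n.factorial : ℝ) := by
  rw [index_levelStab]
  push_cast
  rw [Real.log_pow]
  push_cast
  rfl

theorem log_factorial_pos (hn : 2 ≤ n) : 0 < Real.log (n.factorial : ℝ) := by
  refine Real.log_pos ?_
  exact_mod_cast lt_of_lt_of_le one_lt_two (hn.trans (Nat.self_le_factorial n))

theorem tendsto_index (hn : 2 ≤ n) :
    Tendsto (fun m => ((levelStab n m).index : ℝ)) atTop atTop := by
  have : NeZero n := ⟨by omega⟩
  have h : Tendsto (fun m => Real.log ((levelStab n m).index : ℝ)) atTop atTop := by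
    simp only [log_index_levelStab]
    exact (tendsto_sum_pow (by omega)).atTop_mul_const (log_factorial_pos hn)
  refine (Real.tendsto_exp_atTop.comp h).congr fun m => ?_
  exact Real.exp_log (index_pos m)

theorem IsBranching.tendsto_log_div_log (hn : 2 ≤ n) {G B : Subgroup (TreeAut n)}
    (h : IsBranching G B) (N : Subgroup (Fin n → Equiv.Perm (Fin n)))
    (hN : ∀ f, f ∈ N ↔ ∃ g ∈ G, root g = 1 ∧ ∀ x, root (sec g x) = f x) :
    Tendsto (fun m => Real.log ((levelStab n m).relIndex G : ℝ) /
      Real.log ((levelStab n m).index : ℝ)) atTop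
      (nhds (Real.log (Nat.card N) / (n * Real.log (n.factorial : ℝ)))) := by
  have : NeZero n := ⟨by omega⟩
  rw [← tendsto_add_atTop_iff_nat 1]
  have hS := tendsto_sum_pow (n := n) (by omega)
  have hL := log_factorial_pos hn
  have hn0 : (0 : ℝ) < n := by exact_mod_cast (show 0 < n by omega)
  have h0 := tendsto_inv_atTop_zero.comp hS
  set q : ℝ := Real.log (Nat.card (G.map (rootHom n)) : ℝ)
  set c : ℝ := Real.log (Nat.card N : ℝ)
  -- With s = 1 + n + … + n^(m-1), the ratio at level m + 1 is (q + s c) / ((1 + n s) log n!); both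
  -- sides of the fraction are divided by s.
  have h1 : Tendsto (fun m => ((∑ i ∈ Finset.range m, (n : ℝ) ^ i)⁻¹ * q + c) /
      (((∑ i ∈ Finset.range m, (n : ℝ) ^ i)⁻¹ + n) * Real.log (n.factorial : ℝ))) atTop
      (nhds ((0 * q + c) / ((0 + n) * Real.log (n.factorial : ℝ)))) :=
    ((h0.mul_const q).add_const c).div ((h0.add_const (n : ℝ)).mul_const _) (by positivity)
  simp only [zero_mul, zero_add] at h1
  refine h1.congr' ?_
  filter_upwards [hS.eventually (eventually_gt_atTop 0)] with m hm
  have hq : (Nat.card (G.map (rootHom n)) : ℝ) ≠ 0 := by exact_mod_cast Nat.card_pos.ne'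
  have hc : (Nat.card N : ℝ) ≠ 0 := by exact_mod_cast Nat.card_pos.ne'
  rw [h.relIndex_eq N hN, log_index_levelStab, Finset.sum_range_succ' (fun i => (n : ℝ) ^ i)]
  push_cast
  rw [Real.log_mul hq (pow_ne_zero _ hc), Real.log_pow]
  push_cast
  simp only [pow_succ, ← Finset.sum_mul, pow_zero]
  set s := ∑ i ∈ Finset.range m, (n : ℝ) ^ i
  change _ = (q + s * c) / _
  have : s * n + 1 ≠ 0 := by positivity
  field_simp
  ring

theorem IsBranching.dimH_topologicalClosure (hn : 2 ≤ n) {G B : Subgroup (TreeAut n)}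
    (h : IsBranching G B) (N : Subgroup (Fin n → Equiv.Perm (Fin n)))
    (hN : ∀ f, f ∈ N ↔ ∃ g ∈ G, root g = 1 ∧ ∀ x, root (sec g x) = f x) :
    dimH (G.topologicalClosure : Set (TreeAut n)) =
      ENNReal.ofReal (Real.log (Nat.card N) / (n * Real.log (n.factorial : ℝ))) ∧
    Filter.liminf (fun m : ℕ => Real.log ((levelStab n m).relIndex G.topologicalClosure : ℝ) /
      Real.log ((levelStab n m).index : ℝ)) Filter.atTop =
      Real.log (Nat.card N) / (n * Real.log (n.factorial : ℝ)) := by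
  have hlim := h.tendsto_log_div_log hn N hN
  simp only [← relIndex_topologicalClosure G] at hlim
  have h1 : (1 : ℝ) ≤ Nat.card N := by exact_mod_cast Nat.card_pos (α := N)
  exact ⟨dimH_eq_of_tendsto G.isClosed_topologicalClosure (tendsto_index hn)
    (div_nonneg (Real.log_nonneg h1) (mul_nonneg n.cast_nonneg (log_factorial_pos hn).le)) hlim,
    hlim.liminf_eq⟩

end Limit

end TreeAut

/-! ### The cycles σ_i -/

theorem filter_ne_finRange (m : ℕ) (i : Fin (m + 1)) :
    (List.finRange (m + 1)).filter (· ≠ i) = List.ofFn i.succAbove := by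
  have h1 : ((List.finRange (m + 1)).filter (· ≠ i)).Pairwise (· < ·) :=
    (List.pairwise_lt_finRange _).filter _
  refine List.SortedLT.eq_of_mem_iff h1.sortedLT
    (List.sortedLT_ofFn_iff.2 (Fin.strictMono_succAbove i)) fun x => ?_
  simp only [List.mem_filter, List.mem_finRange, true_and, decide_eq_true_eq, List.mem_ofFn]
  exact Fin.exists_succAbove_eq_iff.symm

theorem sigmaPerm_self {n : ℕ} (i : Fin n) : sigmaPerm n i i = i :=
  List.formPerm_apply_of_notMem (by simp)

/-- In the increasing enumeration of the letters other than `i`, the cycle σ_i is the cyclic shift.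
-/
theorem sigmaPerm_succAbove {m : ℕ} (i : Fin (m + 2)) (k : Fin (m + 1)) :
    sigmaPerm (m + 2) i (i.succAbove k) = i.succAbove (k + 1) := by
  have hnd : (List.ofFn i.succAbove).Nodup :=
    List.nodup_ofFn.2 i.succAbove_right_injective
  have h := List.formPerm_apply_getElem _ hnd k.1 (by simp [k.2])
  rw [sigmaPerm, filter_ne_finRange]
  simp only [List.getElem_ofFn, List.length_ofFn] at h
  rw [h]
  congr 1
  ext
  simp [Fin.val_add]

theorem sigmaPerm_sign {m : ℕ} (i : Fin (m + 3)) :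
    Equiv.Perm.sign (sigmaPerm (m + 3) i) = -(-1) ^ (m + 2) := by
  have hnd : (List.ofFn i.succAbove).Nodup :=
    List.nodup_ofFn.2 i.succAbove_right_injective
  have hl : (List.ofFn i.succAbove).length = m + 2 := List.length_ofFn
  rw [sigmaPerm, filter_ne_finRange, (List.isCycle_formPerm hnd (by omega)).sign,
    List.support_formPerm_of_nodup _ hnd, List.toFinset_card_of_nodup hnd, hl]
  intro x hx
  rw [hx] at hl
  simp at hl

section

variable {n : ℕ} [NeZero n]

/-- With letters read modulo `n`, σ_i is the translation by one that jumps over `i`; the jump itself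
is `sigmaPerm_of_add_one_eq`. This makes the later computations uniform in `i`. -/
theorem sigmaPerm_of_ne (hn : 3 ≤ n) {i x : Fin n} (h1 : x ≠ i) (h2 : x + 1 ≠ i) :
    sigmaPerm n i x = x + 1 := by
  obtain ⟨m, rfl⟩ : ∃ m, n = m + 2 := ⟨n - 2, by omega⟩
  obtain ⟨k, rfl⟩ := Fin.exists_succAbove_eq h1
  rw [sigmaPerm_succAbove]
  ext
  simp only [ne_eq, Fin.ext_iff, Fin.succAbove, Fin.lt_def, Fin.val_add_one, Fin.val_castSucc,
    Fin.val_last, apply_ite Fin.val, Fin.val_succ] at h1 h2 ⊢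
  split_ifs at * <;> omega

theorem sigmaPerm_of_add_one_eq (hn : 3 ≤ n) {i x : Fin n} (h2 : x + 1 = i) :
    sigmaPerm n i x = i + 1 := by
  obtain ⟨m, rfl⟩ : ∃ m, n = m + 2 := ⟨n - 2, by omega⟩
  have h1 : x ≠ i := by
    rintro rfl
    simp at h2
  obtain ⟨k, rfl⟩ := Fin.exists_succAbove_eq h1
  rw [sigmaPerm_succAbove]
  ext
  simp only [ne_eq, Fin.ext_iff, Fin.succAbove, Fin.lt_def, Fin.val_add_one, Fin.val_castSucc,
    Fin.val_last, apply_ite Fin.val, Fin.val_succ] at h1 h2 ⊢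
  split_ifs at * <;> omega

theorem Fin.one_ne_zero_of_three_le (hn : 3 ≤ n) : (1 : Fin n) ≠ 0 := by
  rw [Ne, Fin.ext_iff, Fin.val_one', Fin.val_zero, Nat.mod_eq_of_lt (by omega)]
  omega

theorem Fin.two_ne_zero_of_three_le (hn : 3 ≤ n) : (1 + 1 : Fin n) ≠ 0 := by
  rw [Ne, Fin.ext_iff, Fin.val_add, Fin.val_one', Fin.val_zero,
    Nat.mod_eq_of_lt (show 1 < n by omega), Nat.mod_eq_of_lt (by omega)]
  omega

theorem Fin.add_one_ne_self (hn : 3 ≤ n) (x : Fin n) : x + 1 ≠ x := fun h =>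
  Fin.one_ne_zero_of_three_le hn (add_eq_left.1 h)

theorem Fin.add_one_add_one_ne_self (hn : 3 ≤ n) (x : Fin n) : x + 1 + 1 ≠ x := fun h =>
  Fin.two_ne_zero_of_three_le hn (add_eq_left.1 (by rwa [← add_assoc]))

theorem Fin.sub_one_ne_self (hn : 3 ≤ n) (x : Fin n) : x - 1 ≠ x := fun h =>
  Fin.one_ne_zero_of_three_le hn (sub_eq_self.1 h)

theorem Fin.sub_one_ne_add_one (hn : 3 ≤ n) (x : Fin n) : x - 1 ≠ x + 1 := fun h =>
  Fin.add_one_add_one_ne_self hn x (sub_eq_iff_eq_add.1 h).symm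

end

/-! ### States of the generators and of their quotients -/

namespace TreeAut

theorem root_sec_hanoiGen (n : ℕ) (i : Fin n) : root (hanoiGen n i) = sigmaPerm n i ∧
    ∀ x, sec (hanoiGen n i) x = if x = i then hanoiGen n i else 1 :=
  root_sec_unique fun x w => by
    change sigmaPerm n i x :: (if x = i then wordMap (sigmaPerm n i) i w else w) = _
    split_ifs
    · rfl
    · rw [one_smul]

variable {n : ℕ}

@[simp] theorem root_hanoiGen (i : Fin n) : root (hanoiGen n i) = sigmaPerm n i :=
  (root_sec_hanoiGen n i).1

theorem sec_hanoiGen (i x : Fin n) :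
    sec (hanoiGen n i) x = if x = i then hanoiGen n i else 1 :=
  (root_sec_hanoiGen n i).2 x

theorem hanoiGen_mem (i : Fin n) : hanoiGen n i ∈ hanoiGroup n := Subgroup.subset_closure ⟨i, rfl⟩

theorem sec_mem_hanoiGroup {g : TreeAut n} (hg : g ∈ hanoiGroup n) :
    ∀ x, sec g x ∈ hanoiGroup n := by
  induction hg using Subgroup.closure_induction with
  | mem g hg =>
    obtain ⟨i, rfl⟩ := hg
    intro x
    rw [sec_hanoiGen]
    split_ifs
    · exact hanoiGen_mem i
    · exact one_mem _
  | one => simp [one_mem]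
  | mul g h _ _ hg hh => exact fun x => by rw [sec_mul]; exact mul_mem (hg _) (hh _)
  | inv g _ hg => exact fun x => by rw [sec_inv]; exact inv_mem (hg _)

/-- The element `a_i a_j⁻¹` of the Hanoi towers group. -/
def hanoiQuot (i j : Fin n) : TreeAut n := hanoiGen n i * (hanoiGen n j)⁻¹

theorem hanoiQuot_mem (i j : Fin n) : hanoiQuot i j ∈ hanoiGroup n :=
  mul_mem (hanoiGen_mem i) (inv_mem (hanoiGen_mem j))

/-- The intermediate letter `y`, reached from `x` by a_j⁻¹, is a parameter, so that σ_j⁻¹ never has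
to be evaluated. -/
theorem root_sec_hanoiQuot {i j y x z : Fin n} (hx : sigmaPerm n j y = x)
    (hz : sigmaPerm n i y = z) : root (hanoiQuot i j) x = z ∧ sec (hanoiQuot i j) x =
      (if y = i then hanoiGen n i else 1) * (if y = j then hanoiGen n j else 1)⁻¹ := by
  have hx' : (sigmaPerm n j)⁻¹ x = y := by rw [← hx]; simp
  constructor
  · rw [hanoiQuot, root_mul, root_inv, root_hanoiGen, root_hanoiGen, Equiv.Perm.mul_apply, hx', hz]
  · rw [hanoiQuot, sec_mul, sec_inv, root_inv, root_hanoiGen, hx', sec_hanoiGen, sec_hanoiGen]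

section

variable [NeZero n]

/-- The data of the element `a_i a_{i+1}⁻¹`. -/
theorem root_sec_adj (hn : 3 ≤ n) (i : Fin n) :
    (root (hanoiQuot i (i + 1)) i = i + 1 ∧ sec (hanoiQuot i (i + 1)) i = 1) ∧
    (root (hanoiQuot i (i + 1)) (i + 1) = i + 1 + 1 ∧
      sec (hanoiQuot i (i + 1)) (i + 1) = (hanoiGen n (i + 1))⁻¹) ∧
    (root (hanoiQuot i (i + 1)) (i + 1 + 1) = i ∧
      sec (hanoiQuot i (i + 1)) (i + 1 + 1) = hanoiGen n i) ∧
    ∀ x, x ≠ i → x ≠ i + 1 → x ≠ i + 1 + 1 →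
      root (hanoiQuot i (i + 1)) x = x ∧ sec (hanoiQuot i (i + 1)) x = 1 := by
  have h1 := Fin.one_ne_zero_of_three_le hn
  have n1 := Fin.add_one_ne_self hn
  have n2 := Fin.add_one_add_one_ne_self hn
  have n3 := Fin.sub_one_ne_self hn
  have n4 := Fin.sub_one_ne_add_one hn
  refine ⟨?_, ?_, ?_, fun x hx1 hx2 hx3 => ?_⟩
  · have e1 : i - 1 ≠ i := n3 i
    have e2 : i - 1 ≠ i + 1 := n4 i
    have h := root_sec_hanoiQuot (i := i) (j := i + 1) (y := i - 1) (x := i) (z := i + 1)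
      (by rw [sigmaPerm_of_ne hn e2 (by rw [sub_add_cancel]; exact (n1 i).symm),
        sub_add_cancel])
      (by rw [sigmaPerm_of_add_one_eq hn (sub_add_cancel _ _)])
    simpa [e1, e2] using h
  · have e1 : i + 1 ≠ i := n1 i
    have h := root_sec_hanoiQuot (i := i) (j := i + 1) (y := i + 1) (x := i + 1) (z := i + 1 + 1)
      (sigmaPerm_self _) (by rw [sigmaPerm_of_ne hn e1 (n2 i)])
    simpa [e1, h1] using h
  · have e1 : i ≠ i + 1 := (n1 i).symm
    have h := root_sec_hanoiQuot (i := i) (j := i + 1) (y := i) (x := i + 1 + 1) (z := i)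
      (by rw [sigmaPerm_of_add_one_eq hn rfl]) (sigmaPerm_self _)
    simpa [e1, h1] using h
  · have e1 : x - 1 ≠ i := by grind
    have e2 : x - 1 ≠ i + 1 := by grind
    have h := root_sec_hanoiQuot (i := i) (j := i + 1) (y := x - 1) (x := x) (z := x)
      (by rw [sigmaPerm_of_ne hn e2 (by grind)]; grind)
      (by rw [sigmaPerm_of_ne hn e1 (by grind)]; grind)
    simpa [e1, e2] using h

/-- The data of the element `a_i a_j⁻¹` for letters `i`, `j` which are not adjacent. -/
theorem root_sec_nonadj (hn : 3 ≤ n) {i j : Fin n} (hij : i ≠ j) (hij1 : i + 1 ≠ j)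
    (hji1 : j + 1 ≠ i) :
    (root (hanoiQuot i j) i = i + 1 ∧ sec (hanoiQuot i j) i = 1) ∧
    (root (hanoiQuot i j) (i + 1) = i ∧ sec (hanoiQuot i j) (i + 1) = hanoiGen n i) ∧
    (root (hanoiQuot i j) j = j + 1 ∧ sec (hanoiQuot i j) j = (hanoiGen n j)⁻¹) ∧
    (root (hanoiQuot i j) (j + 1) = j ∧ sec (hanoiQuot i j) (j + 1) = 1) ∧
    ∀ x, x ≠ i → x ≠ i + 1 → x ≠ j → x ≠ j + 1 →
      root (hanoiQuot i j) x = x ∧ sec (hanoiQuot i j) x = 1 := by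
  have n3 := Fin.sub_one_ne_self hn
  refine ⟨?_, ?_, ?_, ?_, fun x hx1 hx2 hx3 hx4 => ?_⟩
  · have e1 : i - 1 ≠ i := n3 i
    have e2 : i - 1 ≠ j := by grind
    have h := root_sec_hanoiQuot (i := i) (j := j) (y := i - 1) (x := i) (z := i + 1)
      (by rw [sigmaPerm_of_ne hn e2 (by rw [sub_add_cancel]; exact hij),
        sub_add_cancel])
      (by rw [sigmaPerm_of_add_one_eq hn (sub_add_cancel _ _)])
    simpa [e1, e2] using h
  · have h := root_sec_hanoiQuot (i := i) (j := j) (y := i) (x := i + 1) (z := i)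
      (by rw [sigmaPerm_of_ne hn hij hij1]) (sigmaPerm_self _)
    simpa [hij] using h
  · have h := root_sec_hanoiQuot (i := i) (j := j) (y := j) (x := j) (z := j + 1)
      (sigmaPerm_self _) (by rw [sigmaPerm_of_ne hn hij.symm hji1])
    simpa [hij.symm] using h
  · have e1 : j - 1 ≠ i := by grind
    have e2 : j - 1 ≠ j := n3 j
    have h := root_sec_hanoiQuot (i := i) (j := j) (y := j - 1) (x := j + 1) (z := j)
      (by rw [sigmaPerm_of_add_one_eq hn (by grind)])
      (by rw [sigmaPerm_of_ne hn e1 (by grind)]; grind)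
    simpa [e1, e2] using h
  · have e1 : x - 1 ≠ i := by grind
    have e2 : x - 1 ≠ j := by grind
    have h := root_sec_hanoiQuot (i := i) (j := j) (y := x - 1) (x := x) (z := x)
      (by rw [sigmaPerm_of_ne hn e2 (by grind)]; grind)
      (by rw [sigmaPerm_of_ne hn e1 (by grind)]; grind)
    simpa [e1, e2] using h

/-- The cube of `a_i a_{i+1}⁻¹`. -/
theorem root_sec_adj_cube (hn : 3 ≤ n) (i : Fin n) :
    root (hanoiQuot i (i + 1) ^ 3) = 1 ∧
    sec (hanoiQuot i (i + 1) ^ 3) i = hanoiQuot i (i + 1) ∧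
    sec (hanoiQuot i (i + 1) ^ 3) (i + 1) = hanoiQuot i (i + 1) ∧
    sec (hanoiQuot i (i + 1) ^ 3) (i + 1 + 1) = (hanoiGen n (i + 1))⁻¹ * hanoiGen n i ∧
    ∀ x, x ≠ i → x ≠ i + 1 → x ≠ i + 1 + 1 → sec (hanoiQuot i (i + 1) ^ 3) x = 1 := by
  obtain ⟨⟨r0, s0⟩, ⟨r1, s1⟩, ⟨r2, s2⟩, hx⟩ := root_sec_adj hn i
  have e : hanoiQuot i (i + 1) ^ 3 =
    hanoiQuot i (i + 1) * (hanoiQuot i (i + 1) * hanoiQuot i (i + 1)) := by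
      rw [pow_succ', pow_two]
  simp only [e, sec_mul, root_mul, Equiv.Perm.mul_apply, r0, r1, r2, s0, s1, s2]
  refine ⟨Equiv.ext fun x => ?_, ?_, ?_, ?_, fun x x1 x2 x3 => ?_⟩
  · by_cases x1 : x = i
    · subst x1; simp [r0, r1, r2]
    by_cases x2 : x = i + 1
    · subst x2; simp [r0, r1, r2]
    by_cases x3 : x = i + 1 + 1
    · subst x3; simp [r0, r1, r2]
    simp [(hx x x1 x2 x3).1]
  · simp [hanoiQuot]
  · simp [hanoiQuot]
  · simp
  · simp [hx x x1 x2 x3]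

/-- The square of `a_i a_j⁻¹` for letters `i`, `j` which are not adjacent. -/
theorem root_sec_nonadj_sq (hn : 3 ≤ n) {i j : Fin n} (hij : i ≠ j) (hij1 : i + 1 ≠ j)
    (hji1 : j + 1 ≠ i) :
    root (hanoiQuot i j ^ 2) = 1 ∧
    sec (hanoiQuot i j ^ 2) i = hanoiGen n i ∧ sec (hanoiQuot i j ^ 2) (i + 1) = hanoiGen n i ∧
    sec (hanoiQuot i j ^ 2) j = (hanoiGen n j)⁻¹ ∧
    ∀ x, x ≠ i → x ≠ i + 1 → x ≠ j → x ≠ j + 1 → sec (hanoiQuot i j ^ 2) x = 1 := by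
  obtain ⟨⟨r0, s0⟩, ⟨r1, s1⟩, ⟨r2, s2⟩, ⟨r3, s3⟩, hx⟩ := root_sec_nonadj hn hij hij1 hji1
  simp only [pow_two, sec_mul, root_mul, r0, r1, r2, s0, s1, s2, s3]
  refine ⟨Equiv.ext fun x => ?_, ?_, ?_, ?_, fun x x1 x2 x3 x4 => ?_⟩
  · by_cases x1 : x = i
    · subst x1; simp [r0, r1]
    by_cases x2 : x = i + 1
    · subst x2; simp [r0, r1]
    by_cases x3 : x = j
    · subst x3; simp [r2, r3]
    by_cases x4 : x = j + 1
    · subst x4; simp [r2, r3]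
    simp [(hx x x1 x2 x3 x4).1]
  · simp
  · simp
  · simp
  · simp [hx x x1 x2 x3 x4]

end

end TreeAut

/-! ### Subgroups generated by three-cycles -/

/-- The cycle `x ↦ y ↦ z ↦ x`, if `x`, `y`, `z` are distinct. -/
def cyc3 {α : Type*} [DecidableEq α] (x y z : α) : Equiv.Perm α :=
  Equiv.swap x y * Equiv.swap y z

section Cyc3

variable {α : Type*} [DecidableEq α] {x y z w : α}

theorem cyc3_apply_left (hxy : x ≠ y) (hxz : x ≠ z) : cyc3 x y z x = y := by
  rw [cyc3, Equiv.Perm.mul_apply, Equiv.swap_apply_of_ne_of_ne hxy hxz, Equiv.swap_apply_left]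

theorem cyc3_apply_middle (hxz : x ≠ z) (hyz : y ≠ z) : cyc3 x y z y = z := by
  rw [cyc3, Equiv.Perm.mul_apply, Equiv.swap_apply_left,
    Equiv.swap_apply_of_ne_of_ne hxz.symm hyz.symm]

theorem cyc3_apply_right : cyc3 x y z z = x := by
  rw [cyc3, Equiv.Perm.mul_apply, Equiv.swap_apply_right, Equiv.swap_apply_right]

theorem cyc3_apply_of_ne (hx : w ≠ x) (hy : w ≠ y) (hz : w ≠ z) : cyc3 x y z w = w := by
  rw [cyc3, Equiv.Perm.mul_apply, Equiv.swap_apply_of_ne_of_ne hy hz,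
    Equiv.swap_apply_of_ne_of_ne hx hy]

theorem eq_cyc3 (hxy : x ≠ y) (hxz : x ≠ z) (hyz : y ≠ z) {τ : Equiv.Perm α} (h1 : τ x = y)
    (h2 : τ y = z) (h3 : τ z = x) (h : ∀ w, w ≠ x → w ≠ y → w ≠ z → τ w = w) :
    τ = cyc3 x y z := by
  ext w
  by_cases hx : w = x
  · rw [hx, cyc3_apply_left hxy hxz, h1]
  by_cases hy : w = y
  · rw [hy, cyc3_apply_middle hxz hyz, h2]
  by_cases hz : w = z
  · rw [hz, cyc3_apply_right, h3]
  rw [cyc3_apply_of_ne hx hy hz, h w hx hy hz]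

theorem cyc3_rotate (hxy : x ≠ y) (hxz : x ≠ z) (hyz : y ≠ z) : cyc3 y z x = cyc3 x y z :=
  eq_cyc3 hxy hxz hyz cyc3_apply_right (cyc3_apply_left hyz hxy.symm)
    (cyc3_apply_middle hxy.symm hxz.symm) fun _ h1 h2 h3 => cyc3_apply_of_ne h2 h3 h1

theorem cyc3_inv (x y z : α) : (cyc3 x y z)⁻¹ = cyc3 z y x := by
  rw [cyc3, cyc3, mul_inv_rev, Equiv.swap_inv, Equiv.swap_inv, Equiv.swap_comm y z,
    Equiv.swap_comm x y]

theorem conj_cyc3 (τ : Equiv.Perm α) (x y z : α) :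
    τ * cyc3 x y z * τ⁻¹ = cyc3 (τ x) (τ y) (τ z) := by
  rw [cyc3, cyc3, Equiv.swap_apply_apply, Equiv.swap_apply_apply]
  group

variable {H : Subgroup (Equiv.Perm α)}

theorem cyc3_mem_rotate (hxy : x ≠ y) (hxz : x ≠ z) (hyz : y ≠ z) (h : cyc3 x y z ∈ H) :
    cyc3 y z x ∈ H := by
  rwa [cyc3_rotate hxy hxz hyz]

theorem cyc3_mem_swap (hxy : x ≠ y) (hxz : x ≠ z) (hyz : y ≠ z) (h : cyc3 x y z ∈ H) :
    cyc3 y x z ∈ H := by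
  have h' := H.inv_mem h
  rw [cyc3_inv] at h'
  exact cyc3_mem_rotate hyz.symm hxz.symm hxy.symm h'

/-- Conjugating (x y z)⁻¹ by (x y w)⁻¹ gives (z x w). -/
theorem cyc3_mem_of_mem_of_mem (hxy : x ≠ y) (hxz : x ≠ z) (hxw : x ≠ w) (hyz : y ≠ z)
    (hzw : z ≠ w) (h1 : cyc3 x y z ∈ H) (h2 : cyc3 x y w ∈ H) : cyc3 x z w ∈ H := by
  have h := H.mul_mem (H.mul_mem (H.inv_mem h2) (H.inv_mem h1)) (H.inv_mem (H.inv_mem h2))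
  rw [cyc3_inv, cyc3_inv, conj_cyc3, cyc3_apply_right, cyc3_apply_middle hxw.symm hxy.symm,
    cyc3_apply_of_ne hzw hyz.symm hxz.symm] at h
  exact cyc3_mem_swap hxz.symm hzw hxw h

/-- Three-cycles on consecutive members of a sequence generate all three-cycles on it. No
wrap-around is assumed, so it applies both to all letters and to the letters following a fixed one.
-/
theorem cyc3_mem_of_consecutive {f : ℕ → α} {N : ℕ}
    (hf : ∀ a b, a < N → b < N → a ≠ b → f a ≠ f b)
    (H0 : ∀ t, t + 2 < N → cyc3 (f t) (f (t + 1)) (f (t + 2)) ∈ H) {a b c : ℕ} (ha : a < N)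
    (hb : b < N) (hc : c < N) (hab : a ≠ b) (hac : a ≠ c) (hbc : b ≠ c) :
    cyc3 (f a) (f b) (f c) ∈ H := by
  have rot : ∀ a b c, a < N → b < N → c < N → a ≠ b → a ≠ c → b ≠ c →
      cyc3 (f a) (f b) (f c) ∈ H → cyc3 (f b) (f c) (f a) ∈ H :=
    fun a b c ha hb hc hab hac hbc =>
      cyc3_mem_rotate (hf _ _ ha hb hab) (hf _ _ ha hc hac) (hf _ _ hb hc hbc)
  have swp : ∀ a b c, a < N → b < N → c < N → a ≠ b → a ≠ c → b ≠ c →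
      cyc3 (f a) (f b) (f c) ∈ H → cyc3 (f b) (f a) (f c) ∈ H :=
    fun a b c ha hb hc hab hac hbc =>
      cyc3_mem_swap (hf _ _ ha hb hab) (hf _ _ ha hc hac) (hf _ _ hb hc hbc)
  have step : ∀ a b c d, a < N → b < N → c < N → d < N → a ≠ b → a ≠ c → a ≠ d → b ≠ c →
      c ≠ d → cyc3 (f a) (f b) (f c) ∈ H → cyc3 (f a) (f b) (f d) ∈ H →
      cyc3 (f a) (f c) (f d) ∈ H :=
    fun a b c d ha hb hc hd hab hac had hbc hcd =>
      cyc3_mem_of_mem_of_mem (hf _ _ ha hb hab) (hf _ _ ha hc hac) (hf _ _ ha hd had)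
        (hf _ _ hb hc hbc) (hf _ _ hc hd hcd)
  -- First the last entry is freed, keeping the first two adjacent; then `h2` frees the middle
  -- entry. What remains is reordering.
  have h1 : ∀ k j, j + k + 2 < N → cyc3 (f j) (f (j + 1)) (f (j + k + 2)) ∈ H := by
    intro k
    induction k with
    | zero => exact fun j hj => H0 j hj
    | succ k ih =>
      intro j hj
      have e1 := ih (j + 1) (by omega)
      have e2 := H0 j (by omega)
      rw [show j + 1 + 1 = j + 2 by omega,
        show j + 1 + k + 2 = j + (k + 1) + 2 by omega] at e1
      exact swp _ _ _ (by omega) (by omega) (by omega) (by omega) (by omega) (by omega)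
        (step _ _ _ _ (by omega) (by omega) (by omega) (by omega) (by omega) (by omega) (by omega)
          (by omega) (by omega)
          (rot _ _ _ (by omega) (by omega) (by omega) (by omega) (by omega) (by omega) e2) e1)
  have h2 : ∀ k j c, j + k + 1 < c → c < N → cyc3 (f j) (f (j + k + 1)) (f c) ∈ H := by
    intro k
    induction k with
    | zero =>
      intro j c hj hc
      have := h1 (c - j - 2) j (by omega)
      rwa [show j + (c - j - 2) + 2 = c by omega] at this
    | succ k ih =>
      intro j c hj hc
      have e1 := ih j c (by omega) hc
      have e2 := h1 (c - (j + k + 1) - 2) (j + k + 1) (by omega)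
      rw [show j + k + 1 + (c - (j + k + 1) - 2) + 2 = c by omega] at e2
      have e3 := step c (j + k + 1) j (j + (k + 1) + 1) (by omega) (by omega) (by omega) (by omega)
        (by omega) (by omega) (by omega) (by omega) (by omega)
        (swp _ _ _ (by omega) (by omega) (by omega) (by omega) (by omega) (by omega)
          (rot _ _ _ (by omega) (by omega) (by omega) (by omega) (by omega) (by omega) e1))
        (rot _ _ _ (by omega) (by omega) (by omega) (by omega) (by omega) (by omega)
          (rot _ _ _ (by omega) (by omega) (by omega) (by omega) (by omega) (by omega) e2))
      exact rot _ _ _ (by omega) (by omega) (by omega) (by omega) (by omega) (by omega) e3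
  have h3 : ∀ a b c, a < b → b < c → c < N → cyc3 (f a) (f b) (f c) ∈ H := by
    intro a b c hab hbc hc
    have := h2 (b - a - 1) a c (by omega) hc
    rwa [show a + (b - a - 1) + 1 = b by omega] at this
  have h4 : ∀ a b c, a < b → a < c → b ≠ c → b < N → c < N → cyc3 (f a) (f b) (f c) ∈ H := by
    intro a b c hab hac hbc hb hc
    rcases lt_or_gt_of_ne hbc with h | h
    · exact h3 a b c hab h hc
    · exact rot _ _ _ hc (by omega) hb (by omega) (by omega) (by omega)
        (swp _ _ _ (by omega) hc hb (by omega) (by omega) (by omega) (h3 a c b hac h hb))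
  by_cases hab' : a < b
  · by_cases hac' : a < c
    · exact h4 a b c hab' hac' hbc hb hc
    · exact rot _ _ _ hc ha hb (by omega) (by omega) hab (h4 c a b (by omega) (by omega) hab ha hb)
  · by_cases hbc' : b < c
    · exact rot _ _ _ hc ha hb hac.symm hbc.symm hab
        (rot _ _ _ hb hc ha hbc hab.symm hac.symm (h4 b c a hbc' (by omega) hac.symm hc ha))
    · exact rot _ _ _ hc ha hb hac.symm hbc.symm hab
        (h4 c a b (by omega) (by omega) hab ha hb)

theorem alternatingGroup_le_of_cyc3_mem [Fintype α]
    (h : ∀ x y z, x ≠ y → x ≠ z → y ≠ z → cyc3 x y z ∈ H) : alternatingGroup α ≤ H := by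
  rw [← Equiv.Perm.closure_three_cycles_eq_alternating, Subgroup.closure_le]
  intro σ hσ
  obtain ⟨a, ha⟩ := hσ.isCycle.nonempty_support
  have hnd := hσ.nodup_iff_mem_support.2 ha
  rw [hσ.eq_swap_mul_swap_iff_mem_support.2 ha]
  simp at hnd
  exact h a (σ a) (σ (σ a)) hnd.1.1 hnd.1.2 fun h' => hnd.1.1 (σ.injective h')

theorem cyc3_mem_alternatingGroup [Fintype α] (hxy : x ≠ y) (hyz : y ≠ z) :
    cyc3 x y z ∈ alternatingGroup α :=
  Equiv.Perm.mul_mem_alternatingGroup_of_isSwap ⟨x, y, hxy, rfl⟩ ⟨y, z, hyz, rfl⟩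

end Cyc3

/-! ### Action of the Hanoi group with prescribed states -/

namespace TreeAut

variable {n : ℕ}

/-- The elements of the Hanoi towers group which fix a letter and act trivially below it. -/
def trivialBelow (i : Fin n) : Subgroup (TreeAut n) where
  carrier := {g | g ∈ hanoiGroup n ∧ root g i = i ∧ sec g i = 1}
  one_mem' := ⟨one_mem _, by simp, by simp⟩
  mul_mem' := by
    rintro g h ⟨hg, hg1, hg2⟩ ⟨hh, hh1, hh2⟩
    exact ⟨mul_mem hg hh, by simp [hg1, hh1], by simp [sec_mul, hg2, hh1, hh2]⟩
  inv_mem' := by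
    rintro g ⟨hg, hg1, hg2⟩
    have h : (root g)⁻¹ i = i := by rw [Equiv.Perm.inv_eq_iff_eq, hg1]
    exact ⟨inv_mem hg, by rw [root_inv, h], by rw [sec_inv, h, hg2, inv_one]⟩

/-- The subgroup generated by the conjugates of the elements `a_i a_{i+1}⁻¹` in the Hanoi towers
group. -/
def hanoiEven (n : ℕ) [NeZero n] : Subgroup (TreeAut n) :=
  Subgroup.closure {h | ∃ g ∈ hanoiGroup n, ∃ i, h = g * hanoiQuot i (i + 1) * g⁻¹}

section

open scoped Fin.CommRing

variable [NeZero n]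

theorem hanoiEven_le : hanoiEven n ≤ hanoiGroup n := by
  rw [hanoiEven, Subgroup.closure_le]
  rintro _ ⟨g, hg, i, rfl⟩
  exact mul_mem (mul_mem hg (hanoiQuot_mem _ _)) (inv_mem hg)

theorem hanoiQuot_add_one_mem (i : Fin n) : hanoiQuot i (i + 1) ∈ hanoiEven n :=
  Subgroup.subset_closure ⟨1, one_mem _, i, by simp⟩

theorem conj_mem_hanoiEven {g e : TreeAut n} (hg : g ∈ hanoiGroup n) (he : e ∈ hanoiEven n) :
    g * e * g⁻¹ ∈ hanoiEven n := by
  induction he using Subgroup.closure_induction with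
  | mem e he =>
    obtain ⟨h, hh, i, rfl⟩ := he
    exact Subgroup.subset_closure ⟨g * h, mul_mem hg hh, i, by group⟩
  | one => simp [one_mem]
  | mul a b _ _ ha hb =>
    rw [show g * (a * b) * g⁻¹ = (g * a * g⁻¹) * (g * b * g⁻¹) by group]
    exact mul_mem ha hb
  | inv a _ ha =>
    rw [show g * a⁻¹ * g⁻¹ = (g * a * g⁻¹)⁻¹ by group]
    exact inv_mem ha

theorem root_adj (hn : 3 ≤ n) (i : Fin n) :
    root (hanoiQuot i (i + 1)) = cyc3 i (i + 1) (i + 1 + 1) := by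
  obtain ⟨⟨r0, -⟩, ⟨r1, -⟩, ⟨r2, -⟩, hx⟩ := root_sec_adj hn i
  exact eq_cyc3 (Fin.add_one_ne_self hn i).symm (Fin.add_one_add_one_ne_self hn i).symm
    (Fin.add_one_ne_self hn (i + 1)).symm r0 r1 r2 fun w h1 h2 h3 => (hx w h1 h2 h3).1

theorem Fin.add_natCast_ne {i : Fin n} {a b : ℕ} (ha : a < n) (hb : b < n) (hab : a ≠ b) :
    i + (a : Fin n) ≠ i + (b : Fin n) := by
  rw [Ne, add_right_inj, Fin.ext_iff, Fin.val_natCast, Fin.val_natCast, Nat.mod_eq_of_lt ha,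
    Nat.mod_eq_of_lt hb]
  exact hab

theorem Fin.exists_eq_add_natCast (i x : Fin n) : ∃ a < n, x = i + (a : Fin n) :=
  ⟨(x - i).val, (x - i).isLt, by rw [Fin.cast_val_eq_self, add_sub_cancel]⟩

/-- Every cycle of length three is the action on the letters of an element of `hanoiEven`. -/
theorem exists_hanoiEven_root_cyc3 (hn : 3 ≤ n) {x y z : Fin n} (hxy : x ≠ y) (hxz : x ≠ z)
    (hyz : y ≠ z) : cyc3 x y z ∈ (hanoiEven n).map (rootHom n) := by
  obtain ⟨a, ha, rfl⟩ := Fin.exists_eq_add_natCast 0 x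
  obtain ⟨b, hb, rfl⟩ := Fin.exists_eq_add_natCast 0 y
  obtain ⟨c, hc, rfl⟩ := Fin.exists_eq_add_natCast 0 z
  refine cyc3_mem_of_consecutive (f := fun t => (0 : Fin n) + (t : Fin n)) (N := n)
    (fun a b => Fin.add_natCast_ne) ?_ ha hb hc ?_ ?_ ?_
  · intro t _
    refine ⟨hanoiQuot (t : Fin n) (t + 1), hanoiQuot_add_one_mem _, ?_⟩
    rw [rootHom_apply, root_adj hn]
    simp only [Nat.cast_add, Nat.cast_one, zero_add, ← add_assoc, Nat.cast_ofNat]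
    congr 1
    rw [add_assoc, one_add_one_eq_two]
  · rintro rfl; exact hxy rfl
  · rintro rfl; exact hxz rfl
  · rintro rfl; exact hyz rfl

theorem alternatingGroup_le_map_hanoiEven (hn : 3 ≤ n) :
    alternatingGroup (Fin n) ≤ (hanoiEven n).map (rootHom n) :=
  alternatingGroup_le_of_cyc3_mem fun _ _ _ => exists_hanoiEven_root_cyc3 hn

/-- Every cycle of length three on the letters different from `i` is the action of an element
which is trivial below `i`. -/
theorem exists_trivialBelow_root_cyc3 (hn : 3 ≤ n) {i x y z : Fin n} (hx : x ≠ i) (hy : y ≠ i)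
    (hz : z ≠ i) (hxy : x ≠ y) (hxz : x ≠ z) (hyz : y ≠ z) :
    ∃ t ∈ trivialBelow i, root t = cyc3 x y z := by
  obtain ⟨a, ha, rfl⟩ := Fin.exists_eq_add_natCast i x
  obtain ⟨b, hb, rfl⟩ := Fin.exists_eq_add_natCast i y
  obtain ⟨c, hc, rfl⟩ := Fin.exists_eq_add_natCast i z
  have hpos : ∀ a : ℕ, i + (a : Fin n) ≠ i → a ≠ 0 := by
    rintro _ h rfl
    exact h (by simp)
  obtain ⟨a, rfl⟩ := Nat.exists_eq_succ_of_ne_zero (hpos a hx)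
  obtain ⟨b, rfl⟩ := Nat.exists_eq_succ_of_ne_zero (hpos b hy)
  obtain ⟨c, rfl⟩ := Nat.exists_eq_succ_of_ne_zero (hpos c hz)
  change _ ∈ (trivialBelow i).map (rootHom n)
  -- The sequence i+1, …, i+n-1 omits `i`, so a consecutive triple j, j+1, j+2 avoids `i` and a_j
  -- a_{j+1}⁻¹ is trivial below `i`.
  refine cyc3_mem_of_consecutive (f := fun t => i + ((t + 1 : ℕ) : Fin n)) (N := n - 1)
    (fun a b _ _ _ => Fin.add_natCast_ne (by omega) (by omega) (by omega)) ?_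
    (by omega) (by omega) (by omega) ?_ ?_ ?_
  · intro t ht
    have hz0 : i = i + ((0 : ℕ) : Fin n) := by simp
    have n0 : i ≠ i + ((t + 1 : ℕ) : Fin n) := by
      conv_lhs => rw [hz0]
      exact Fin.add_natCast_ne (by omega) (by omega) (by omega)
    have n1 : i ≠ i + ((t + 2 : ℕ) : Fin n) := by
      conv_lhs => rw [hz0]
      exact Fin.add_natCast_ne (by omega) (by omega) (by omega)
    have n2 : i ≠ i + ((t + 3 : ℕ) : Fin n) := by
      conv_lhs => rw [hz0]
      exact Fin.add_natCast_ne (by omega) (by omega) (by omega)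
    set j : Fin n := i + ((t + 1 : ℕ) : Fin n) with hj
    have e1 : i + ((t + 2 : ℕ) : Fin n) = j + 1 := by
      rw [hj, add_assoc, ← Nat.cast_add_one]
    have e2 : i + ((t + 3 : ℕ) : Fin n) = j + 1 + 1 := by
      rw [← e1, add_assoc, ← Nat.cast_add_one]
    rw [e1] at n1
    rw [e2] at n2
    obtain ⟨-, -, -, hd⟩ := root_sec_adj hn j
    refine ⟨hanoiQuot j (j + 1), ⟨hanoiQuot_mem _ _, hd i n0 n1 n2⟩, ?_⟩
    rw [rootHom_apply, root_adj hn, ← e2, ← e1]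
  · rintro rfl; exact hxy rfl
  · rintro rfl; exact hxz rfl
  · rintro rfl; exact hyz rfl

/-- The pair is moved only up to order: when few letters besides `i` remain, three-cycles on them
cannot prescribe the order. -/
theorem exists_trivialBelow_pair (hn : 3 ≤ n) {i j l y z : Fin n} (hj : j ≠ i) (hl : l ≠ i)
    (hy : y ≠ i) (hz : z ≠ i) (hjl : j ≠ l) (hyz : y ≠ z) :
    ∃ t ∈ trivialBelow i, (root t j = y ∧ root t l = z) ∨ (root t j = z ∧ root t l = y) := by
  have key : ∀ {j l y}, j ≠ i → l ≠ i → y ≠ i → j ≠ l → y ≠ j → y ≠ l →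
      ∃ t ∈ trivialBelow i, root t j = l ∧ root t l = y := by
    intro j l y hj hl hy hjl hyj hyl
    obtain ⟨t, ht, hr⟩ := exists_trivialBelow_root_cyc3 hn hj hl hy hjl hyj.symm hyl.symm
    exact ⟨t, ht, by rw [hr, cyc3_apply_left hjl hyj.symm],
      by rw [hr, cyc3_apply_middle hyj.symm hyl.symm]⟩
  by_cases hyj : y = j
  · subst hyj
    by_cases hzl : z = l
    · exact ⟨1, one_mem _, Or.inl (by simp [hzl])⟩
    · obtain ⟨t, ht, h1, h2⟩ := key hl hj hz hjl.symm hzl hyz.symm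
      exact ⟨t, ht, Or.inr ⟨h2, h1⟩⟩
  by_cases hyl : y = l
  · subst hyl
    by_cases hzj : z = j
    · exact ⟨1, one_mem _, Or.inr (by simp [hzj])⟩
    · obtain ⟨t, ht, h1, h2⟩ := key hj hl hz hjl hzj hyz.symm
      exact ⟨t, ht, Or.inl ⟨h1, h2⟩⟩
  by_cases hzj : z = j
  · subst hzj
    obtain ⟨t, ht, h1, h2⟩ := key hl hj hy hjl.symm hyl hyj
    exact ⟨t, ht, Or.inl ⟨h2, h1⟩⟩
  obtain ⟨t, ht, h1, h2⟩ := key hj hl hy hjl hyj hyl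
  by_cases hzl : z = l
  · subst hzl
    exact ⟨t, ht, Or.inr ⟨h1, h2⟩⟩
  obtain ⟨t', ht', h1', h2'⟩ := key hl hy hz (Ne.symm hyl) hzl hyz.symm
  exact ⟨t' * t, mul_mem ht' ht, Or.inl (by simp [h1, h2, h1', h2'])⟩

/-- The element a_i a_{i+1}⁻¹ moves `i` to `i + 1` with trivial state there; such moves are chained.
-/
theorem exists_root_eq_sec_eq_one (hn : 3 ≤ n) (j k : Fin n) :
    ∃ s ∈ hanoiEven n, root s j = k ∧ sec s j = 1 := by
  obtain ⟨a, -, rfl⟩ := Fin.exists_eq_add_natCast j k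
  induction a with
  | zero => exact ⟨1, one_mem _, by simp⟩
  | succ a ih =>
    obtain ⟨s, hs, h1, h2⟩ := ih
    obtain ⟨⟨r0, s0⟩, -⟩ := root_sec_adj hn (j + (a : Fin n))
    exact ⟨_, mul_mem (hanoiQuot_add_one_mem (j + (a : Fin n))) hs,
      by rw [root_mul, Equiv.Perm.mul_apply, h1, r0, Nat.cast_add_one, add_assoc],
      by rw [sec_mul, h1, h2, s0, one_mul]⟩

/-- The Hanoi towers group is self-replicating. -/
theorem exists_root_eq_sec_eq (hn : 3 ≤ n) {g : TreeAut n} (hg : g ∈ hanoiGroup n) (x : Fin n) :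
    ∃ k ∈ hanoiGroup n, root k x = x ∧ sec k x = g := by
  induction hg using Subgroup.closure_induction with
  | mem g hg =>
    obtain ⟨j, rfl⟩ := hg
    obtain ⟨s, hs, h1, h2⟩ := exists_root_eq_sec_eq_one hn j x
    have hs' := hanoiEven_le hs
    refine ⟨s * hanoiGen n j * s⁻¹, mul_mem (mul_mem hs' (hanoiGen_mem j)) (inv_mem hs'), ?_, ?_⟩
    · have : (root s).symm x = j := by rw [← h1]; simp
      simp [this, sigmaPerm_self, h1]
    · rw [← h1, sec_conj, root_hanoiGen, sigmaPerm_self, h2, sec_hanoiGen]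
      simp
  | one => exact ⟨1, one_mem _, by simp⟩
  | mul a b _ _ ha hb =>
    obtain ⟨k, hk, h1, h2⟩ := ha
    obtain ⟨l, hl, h1', h2'⟩ := hb
    exact ⟨k * l, mul_mem hk hl, by simp [h1, h1'], by rw [sec_mul, h1', h2, h2']⟩
  | inv a _ ha =>
    obtain ⟨k, hk, h1, h2⟩ := ha
    have h : (root k)⁻¹ x = x := by rw [Equiv.Perm.inv_eq_iff_eq, h1]
    exact ⟨k⁻¹, inv_mem hk, by rw [root_inv, h], by rw [sec_inv, h, h2]⟩

theorem exists_root_eq_sec_eq' (hn : 3 ≤ n) {g : TreeAut n} (hg : g ∈ hanoiGroup n)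
    (i x : Fin n) : ∃ k ∈ hanoiGroup n, root k i = x ∧ sec k i = g := by
  obtain ⟨s, hs, h1, h2⟩ := exists_root_eq_sec_eq_one hn i x
  obtain ⟨k, hk, h3, h4⟩ := exists_root_eq_sec_eq hn hg x
  exact ⟨k * s, mul_mem hk (hanoiEven_le hs), by simp [h1, h3], by rw [sec_mul, h1, h2, h4, mul_one]⟩

/-- Three letters can be moved to three letters with prescribed state at the first one. -/
theorem exists_root_triple (hn : 3 ≤ n) {g : TreeAut n} (hg : g ∈ hanoiGroup n)
    {i j l x y z : Fin n} (hij : j ≠ i) (hil : l ≠ i) (hjl : j ≠ l) (hxy : y ≠ x) (hxz : z ≠ x)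
    (hyz : y ≠ z) : ∃ k ∈ hanoiGroup n, root k i = x ∧ sec k i = g ∧
      ((root k j = y ∧ root k l = z) ∨ (root k j = z ∧ root k l = y)) := by
  obtain ⟨k, hk, h1, h2⟩ := exists_root_eq_sec_eq' hn hg i x
  obtain ⟨y', rfl⟩ := (root k).surjective y
  obtain ⟨z', rfl⟩ := (root k).surjective z
  obtain ⟨t, ⟨ht, ht1, ht2⟩, h⟩ := exists_trivialBelow_pair hn (i := i) (y := y') (z := z') hij hil
    (by rintro rfl; exact hxy h1) (by rintro rfl; exact hxz h1) hjl (by rintro rfl; exact hyz rfl)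
  refine ⟨k * t, mul_mem hk ht, by simp [ht1, h1], by rw [sec_mul, ht1, ht2, h2, mul_one], ?_⟩
  rcases h with ⟨e1, e2⟩ | ⟨e1, e2⟩
  · exact Or.inl (by simp [e1, e2])
  · exact Or.inr (by simp [e1, e2])

end

end TreeAut

/-! ### Classes of the states in the abelianization of Σ -/

section ClassInAbelianization

variable {G : Type*} [Group G] (T : Subgroup G)

open Classical in
/-- The class of an element of the subgroup `T` in the abelianization of `T`, and `1` for elements
outside of `T`. -/
noncomputable def abClass (g : G) : Abelianization T :=
  if h : g ∈ T then Abelianization.of ⟨g, h⟩ else 1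

variable {T}

theorem abClass_of_mem {g : G} (hg : g ∈ T) : abClass T g = Abelianization.of ⟨g, hg⟩ := dif_pos hg

theorem abClass_mul {g h : G} (hg : g ∈ T) (hh : h ∈ T) :
    abClass T (g * h) = abClass T g * abClass T h := by
  rw [abClass_of_mem hg, abClass_of_mem hh, abClass_of_mem (mul_mem hg hh), ← map_mul]
  rfl

theorem abClass_one : abClass T 1 = 1 := by
  rw [abClass_of_mem (one_mem T)]
  exact map_one _

theorem abClass_inv {g : G} (hg : g ∈ T) : abClass T g⁻¹ = (abClass T g)⁻¹ := by
  rw [abClass_of_mem hg, abClass_of_mem (inv_mem hg), ← map_inv]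
  rfl

theorem abClass_eq_one_iff {g : G} (hg : g ∈ T) : abClass T g = 1 ↔ g ∈ ⁅T, T⁆ := by
  rw [abClass_of_mem hg, ← MonoidHom.mem_ker, Abelianization.ker_of, ← Subgroup.map_subtype_commutator]
  constructor
  · exact fun h => ⟨_, h, rfl⟩
  · rintro ⟨x, hx, rfl⟩
    exact hx

end ClassInAbelianization

/-- The group of permutations generated by the cycles `σ_i`. -/
def sigmaGroup (n : ℕ) : Subgroup (Equiv.Perm (Fin n)) := Subgroup.closure (Set.range (sigmaPerm n))

namespace TreeAut

variable {n : ℕ}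

theorem map_rootHom_hanoiGroup (n : ℕ) : (hanoiGroup n).map (rootHom n) = sigmaGroup n := by
  rw [hanoiGroup, MonoidHom.map_closure, ← Set.range_comp, sigmaGroup]
  congr 2
  funext i
  exact root_hanoiGen i

theorem root_mem_sigmaGroup {g : TreeAut n} (hg : g ∈ hanoiGroup n) : root g ∈ sigmaGroup n := by
  rw [← map_rootHom_hanoiGroup]
  exact ⟨g, hg, rfl⟩

/-- The classes, in the abelianization of `sigmaGroup n`, of the actions of the states of `g` at the
letters. -/
noncomputable def secClass (g : TreeAut n) (x : Fin n) : Abelianization (sigmaGroup n) :=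
  abClass (sigmaGroup n) (root (sec g x))

theorem secClass_mul {g h : TreeAut n} (hg : g ∈ hanoiGroup n) (hh : h ∈ hanoiGroup n) (x : Fin n) :
    secClass (g * h) x = secClass g (root h x) * secClass h x := by
  rw [secClass, sec_mul, root_mul, abClass_mul (root_mem_sigmaGroup (sec_mem_hanoiGroup hg _))
    (root_mem_sigmaGroup (sec_mem_hanoiGroup hh _))]
  rfl

theorem secClass_one : secClass (1 : TreeAut n) = 1 := by
  funext x
  rw [secClass, sec_one, root_one, abClass_one, Pi.one_apply]

theorem secClass_inv {g : TreeAut n} (hg : g ∈ hanoiGroup n) (x : Fin n) :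
    secClass g⁻¹ x = (secClass g ((root g)⁻¹ x))⁻¹ := by
  rw [secClass, sec_inv, root_inv, abClass_inv (root_mem_sigmaGroup (sec_mem_hanoiGroup hg _))]
  rfl

/-- Conjugation permutes the states and conjugates them; the abelianization only sees the
permutation. -/
theorem secClass_conj {g h : TreeAut n} (hg : g ∈ hanoiGroup n) (hh : h ∈ hanoiGroup n)
    (hh1 : root h = 1) (x : Fin n) : secClass (g * h * g⁻¹) x = secClass h ((root g)⁻¹ x) := by
  rw [secClass_mul (mul_mem hg hh) (inv_mem hg), secClass_mul hg hh, secClass_inv hg, hh1, root_inv]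
  exact mul_inv_cancel_comm _ _

/-- The relation behind the dimension formula. A generator a_i has a single nontrivial state, namely
itself, and permuting the letters does not affect a product in an abelian group. -/
theorem prod_secClass {g : TreeAut n} (hg : g ∈ hanoiGroup n) :
    ∏ x, secClass g x = abClass (sigmaGroup n) (root g) := by
  induction hg using Subgroup.closure_induction with
  | mem g hg =>
    obtain ⟨i, rfl⟩ := hg
    rw [Finset.prod_eq_single i]
    · simp [secClass, sec_hanoiGen]
    · intro x _ hx
      simp [secClass, sec_hanoiGen, hx, abClass_one]
    · simp
  | one => simp [secClass_one, abClass_one]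
  | mul g h hg hh ihg ihh =>
    rw [root_mul, abClass_mul (root_mem_sigmaGroup hg) (root_mem_sigmaGroup hh), ← ihg, ← ihh,
      ← Equiv.prod_comp (root h) (secClass g), ← Finset.prod_mul_distrib]
    exact Finset.prod_congr rfl fun x _ => secClass_mul hg hh x
  | inv g hg ih =>
    rw [root_inv, abClass_inv (root_mem_sigmaGroup hg), ← ih,
      ← Equiv.prod_comp (root g)⁻¹ (secClass g), ← Finset.prod_inv_distrib]
    exact Finset.prod_congr rfl fun x _ => secClass_inv hg x

/-- The vectors of classes of the elements of `B` which fix the letters. -/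
def classVectors {B : Subgroup (TreeAut n)} (hB : B ≤ hanoiGroup n) :
    Subgroup (Fin n → Abelianization (sigmaGroup n)) where
  carrier := {v | ∃ b ∈ B, root b = 1 ∧ secClass b = v}
  one_mem' := ⟨1, one_mem _, root_one, secClass_one⟩
  mul_mem' := by
    rintro _ _ ⟨a, ha, ha1, rfl⟩ ⟨b, hb, hb1, rfl⟩
    refine ⟨a * b, mul_mem ha hb, by simp [ha1, hb1], funext fun x => ?_⟩
    rw [secClass_mul (hB ha) (hB hb), hb1]
    rfl
  inv_mem' := by
    rintro _ ⟨a, ha, ha1, rfl⟩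
    refine ⟨a⁻¹, inv_mem ha, by simp [ha1], funext fun x => ?_⟩
    rw [secClass_inv (hB ha), ha1]
    rfl

theorem mulSingle_comp_symm {M : Type*} [Group M] (τ : Equiv.Perm (Fin n)) (p : Fin n) (a : M) :
    (fun x => Pi.mulSingle (M := fun _ => M) p a (τ⁻¹ x)) =
      Pi.mulSingle (M := fun _ => M) (τ p) a := by
  funext x
  simp only [Pi.mulSingle_apply, Equiv.Perm.inv_eq_iff_eq]

/-- If a permutation matching the pairs is odd, composing it with the swap of `p'` and `q'` repairs
the parity at the price of the order. For vectors a, a⁻¹ the order is harmless: replace a by a⁻¹. -/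
theorem exists_mem_alternatingGroup {α : Type*} [Fintype α] [DecidableEq α] {p q p' q' : α}
    (h : p ≠ q) (h' : p' ≠ q') : ∃ τ ∈ alternatingGroup α,
      (τ p = p' ∧ τ q = q') ∨ (τ p = q' ∧ τ q = p') := by
  set u := Equiv.swap p p' q
  have hu : p' ≠ u := by
    intro e
    refine h ((Equiv.swap p p').injective ?_)
    rw [Equiv.swap_apply_left]
    exact e
  set τ : Equiv.Perm α := Equiv.swap u q' * Equiv.swap p p' with hτ
  have hp : τ p = p' := by
    rw [hτ, Equiv.Perm.mul_apply, Equiv.swap_apply_left, Equiv.swap_apply_of_ne_of_ne hu h']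
  have hq : τ q = q' := by
    rw [hτ, Equiv.Perm.mul_apply, Equiv.swap_apply_left]
  rcases Int.units_eq_one_or (Equiv.Perm.sign τ) with h1 | h1
  · exact ⟨τ, h1, Or.inl ⟨hp, hq⟩⟩
  · refine ⟨Equiv.swap p' q' * τ, ?_, Or.inr ⟨?_, ?_⟩⟩
    · rw [Equiv.Perm.mem_alternatingGroup, map_mul, h1, Equiv.Perm.sign_swap h']
      rfl
    · rw [Equiv.Perm.mul_apply, hp, Equiv.swap_apply_left]
    · rw [Equiv.Perm.mul_apply, hq, Equiv.swap_apply_right]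

/-- The possible actions of the states at the letters of an element of the Hanoi towers group which
fixes the letters. -/
def levelOneGroup (n : ℕ) : Subgroup (Fin n → Equiv.Perm (Fin n)) where
  carrier := {f | (∀ x, f x ∈ sigmaGroup n) ∧ ∏ x, abClass (sigmaGroup n) (f x) = 1}
  one_mem' := ⟨fun _ => one_mem _, by simp [abClass_one]⟩
  mul_mem' := by
    rintro f g ⟨hf, hf1⟩ ⟨hg, hg1⟩
    refine ⟨fun x => mul_mem (hf x) (hg x), ?_⟩
    simp only [Pi.mul_apply, abClass_mul (hf _) (hg _), Finset.prod_mul_distrib, hf1, hg1, mul_one]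
  inv_mem' := by
    rintro f ⟨hf, hf1⟩
    refine ⟨fun x => inv_mem (hf x), ?_⟩
    simp only [Pi.inv_apply, abClass_inv (hf _), Finset.prod_inv_distrib, hf1, inv_one]

theorem root_sec_mem_levelOneGroup {g : TreeAut n} (hg : g ∈ hanoiGroup n) (hg1 : root g = 1) :
    (fun x => root (sec g x)) ∈ levelOneGroup n :=
  ⟨fun x => root_mem_sigmaGroup (sec_mem_hanoiGroup hg x), by
    have := prod_secClass hg
    rwa [hg1, abClass_one] at this⟩

section

variable [NeZero n] {B : Subgroup (TreeAut n)}

/-- Conjugation carries the vectors a, a⁻¹ at `p`, `q` to every pair of letters, and these generate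
all vectors of product 1. -/
theorem mem_classVectors_of_pair (hn : 3 ≤ n) (hB : B ≤ hanoiGroup n)
    (hconj : ∀ g ∈ hanoiGroup n, ∀ b ∈ B, g * b * g⁻¹ ∈ B) {p q : Fin n} (hpq : p ≠ q)
    (h : ∀ a, Pi.mulSingle p a * Pi.mulSingle q a⁻¹ ∈ classVectors hB)
    {v : Fin n → Abelianization (sigmaGroup n)} (hv : ∏ x, v x = 1) : v ∈ classVectors hB := by
  have key : ∀ p' q', p' ≠ q' → ∀ a,
      Pi.mulSingle p' a * Pi.mulSingle q' a⁻¹ ∈ classVectors hB := by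
    intro p' q' hpq' a
    have move : ∀ a, ∀ τ ∈ alternatingGroup (Fin n),
        Pi.mulSingle (τ p) a * Pi.mulSingle (τ q) a⁻¹ ∈ classVectors hB := by
      intro a τ hτ
      obtain ⟨g, hg, rfl⟩ := alternatingGroup_le_map_hanoiEven hn hτ
      obtain ⟨b, hb, hb1, hbv⟩ := h a
      have hgG := hanoiEven_le hg
      refine ⟨g * b * g⁻¹, hconj g hgG b hb, by simp [hb1], funext fun x => ?_⟩
      rw [secClass_conj hgG (hB hb) hb1, hbv, rootHom_apply, ← mulSingle_comp_symm,
        ← mulSingle_comp_symm]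
      rfl
    obtain ⟨τ, hτ, ⟨h1, h2⟩ | ⟨h1, h2⟩⟩ := exists_mem_alternatingGroup hpq hpq'
    · have := move a τ hτ
      rwa [h1, h2] at this
    · have := move a⁻¹ τ hτ
      rwa [h1, h2, inv_inv, mul_comm] at this
  -- The correcting entries at `p` multiply to the inverse of the product of `v`, which is 1.
  have hv' : v = ∏ x, (Pi.mulSingle x (v x) * Pi.mulSingle p (v x)⁻¹) := by
    rw [Finset.prod_mul_distrib, Finset.univ_prod_mulSingle]
    have := map_prod (MonoidHom.mulSingle (fun _ : Fin n => Abelianization (sigmaGroup n)) p)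
      (fun x => (v x)⁻¹) Finset.univ
    rw [Finset.prod_inv_distrib, hv, inv_one, map_one] at this
    simp only [MonoidHom.mulSingle_apply] at this
    rw [← this, mul_one]
  rw [hv']
  refine prod_mem fun x _ => ?_
  rcases eq_or_ne x p with rfl | hx
  · rw [← Pi.mulSingle_mul, mul_inv_cancel, Pi.mulSingle_one]
    exact one_mem _
  · exact key x p hx _

/-- A criterion for a normal subgroup of the Hanoi towers group to act on the second level as much
as the relations between the actions of the states allow. -/
theorem exists_root_sec_of_pair (hn : 3 ≤ n) (hB : B ≤ hanoiGroup n)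
    (hconj : ∀ g ∈ hanoiGroup n, ∀ b ∈ B, g * b * g⁻¹ ∈ B)
    (hsingle : ∀ x, ∀ b ∈ B, single x b ∈ B)
    (hroot : ⁅sigmaGroup n, sigmaGroup n⁆ ≤ B.map (rootHom n)) {p q : Fin n} (hpq : p ≠ q)
    (h : ∀ a, Pi.mulSingle p a * Pi.mulSingle q a⁻¹ ∈ classVectors hB)
    {f : Fin n → Equiv.Perm (Fin n)} (hf : ∀ x, f x ∈ sigmaGroup n)
    (hf1 : ∏ x, abClass (sigmaGroup n) (f x) = 1) :
    ∃ b ∈ B, root b = 1 ∧ ∀ x, root (sec b x) = f x := by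
  obtain ⟨b, hb, hb1, hbf⟩ := mem_classVectors_of_pair hn hB hconj hpq h hf1
  -- The class vector determines the actions only modulo [Σ,Σ]; the discrepancy at each letter is
  -- supplied by an element of `B` placed below it.
  have hc : ∀ x, (root (sec b x))⁻¹ * f x ∈ B.map (rootHom n) := fun x => by
    have hx := root_mem_sigmaGroup (sec_mem_hanoiGroup (hB hb) x)
    refine hroot ((abClass_eq_one_iff (mul_mem (inv_mem hx) (hf x))).1 ?_)
    rw [abClass_mul (inv_mem hx) (hf x), abClass_inv hx]
    exact inv_mul_eq_one.2 (congrFun hbf x)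
  choose c hcB hc using hc
  refine ⟨b * wreathHom n c, mul_mem hb (wreathHom_mem hsingle hcB), by simp [hb1], fun x => ?_⟩
  have := hc x
  rw [rootHom_apply] at this
  rw [sec_mul]
  simp [this]

/-- The group is the kernel of the product-of-classes map Σ^n → Σ^ab, which is already surjective on
one coordinate. -/
theorem card_levelOneGroup : Nat.card (levelOneGroup n) * Nat.card (Abelianization (sigmaGroup n)) =
    Nat.card (sigmaGroup n) ^ n := by
  let φ : (Fin n → sigmaGroup n) →* Abelianization (sigmaGroup n) :=
    { toFun := fun f => ∏ x, Abelianization.of (f x)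
      map_one' := by simp
      map_mul' := fun f g => by simp [Finset.prod_mul_distrib] }
  have hφ : Function.Surjective φ := by
    intro a
    obtain ⟨s, rfl⟩ := QuotientGroup.mk_surjective a
    refine ⟨Pi.mulSingle 0 s, ?_⟩
    change ∏ x : Fin n, Abelianization.of (Pi.mulSingle (M := fun _ => sigmaGroup n) 0 s x) = _
    rw [Finset.prod_eq_single 0]
    · simp
      rfl
    · intro x _ hx
      rw [Pi.mulSingle_eq_of_ne hx, map_one]
    · simp
  have e : levelOneGroup n ≃ φ.ker :=
    { toFun := fun f => ⟨fun x => ⟨f.1 x, f.2.1 x⟩, by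
        have := f.2.2
        simp only [abClass_of_mem (f.2.1 _)] at this
        exact this⟩
      invFun := fun f => ⟨fun x => (f.1 x).1, fun x => (f.1 x).2, by
        have := f.2
        simp only [abClass_of_mem (f.1 _).2]
        exact this⟩
      left_inv := fun _ => rfl
      right_inv := fun _ => rfl }
  have h := φ.ker.card_mul_index
  rw [Subgroup.index_ker, MonoidHom.range_eq_top.2 hφ, Subgroup.card_top] at h
  rw [Nat.card_congr e, h, Nat.card_fun]
  simp

/-- The existence of a normal subgroup which contains its copies below the letters and acts
sufficiently on the first two levels. -/
def HasBranchingSubgroup (n : ℕ) : Prop :=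
  ∃ B : Subgroup (TreeAut n), ∃ hB : B ≤ hanoiGroup n,
    (∀ g ∈ hanoiGroup n, ∀ b ∈ B, g * b * g⁻¹ ∈ B) ∧
    (∀ x, ∀ b ∈ B, single x b ∈ B) ∧
    ⁅sigmaGroup n, sigmaGroup n⁆ ≤ B.map (rootHom n) ∧
    ∃ p q : Fin n, p ≠ q ∧ ∀ a, Pi.mulSingle p a * Pi.mulSingle q a⁻¹ ∈ classVectors hB

theorem HasBranchingSubgroup.dimH_eq (hn : 3 ≤ n) (h : HasBranchingSubgroup n) :
    dimH ((hanoiGroup n).topologicalClosure : Set (TreeAut n)) =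
      ENNReal.ofReal (Real.log (Nat.card (levelOneGroup n)) /
        (n * Real.log (n.factorial : ℝ))) ∧
    Filter.liminf (fun m : ℕ =>
      Real.log ((levelStab n m).relIndex (hanoiGroup n).topologicalClosure : ℝ) /
      Real.log ((levelStab n m).index : ℝ)) Filter.atTop =
      Real.log (Nat.card (levelOneGroup n)) / (n * Real.log (n.factorial : ℝ)) := by
  obtain ⟨B, hB, hconj, hsingle, hroot, p, q, hpq, hv⟩ := h
  have key := fun {f} (hf : f ∈ levelOneGroup n) =>
    exists_root_sec_of_pair hn hB hconj hsingle hroot hpq hv hf.1 hf.2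
  have hbr : IsBranching (hanoiGroup n) B :=
    ⟨hB, fun g hg => sec_mem_hanoiGroup hg, hsingle,
      fun g hg hg1 => key (root_sec_mem_levelOneGroup hg hg1)⟩
  refine hbr.dimH_topologicalClosure (by omega) (levelOneGroup n) fun f => ⟨fun hf => ?_, ?_⟩
  · obtain ⟨b, hb, h1, h2⟩ := key hf
    exact ⟨b, hB hb, h1, h2⟩
  · rintro ⟨g, hg, h1, h2⟩
    rw [← funext h2]
    exact root_sec_mem_levelOneGroup hg h1

end

end TreeAut

/-! ### The branching subgroup [[E,E],E] for n ≥ 4 -/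

namespace TreeAut

open scoped commutatorElement

variable {n : ℕ}

/-- The states below `x` of the elements of `K` which fix the letters and are trivial below the
letters outside of `T ∪ {x}`. -/
def partialStates (K : Subgroup (TreeAut n)) (T : Set (Fin n)) (x : Fin n) :
    Subgroup (TreeAut n) where
  carrier := {g | ∃ h ∈ K, root h = 1 ∧ sec h x = g ∧ ∀ w ∉ T, w ≠ x → sec h w = 1}
  one_mem' := ⟨1, one_mem _, by simp, by simp, by simp⟩
  mul_mem' := by
    rintro _ _ ⟨g, hg, hg1, rfl, hgT⟩ ⟨h, hh, hh1, rfl, hhT⟩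
    refine ⟨g * h, mul_mem hg hh, by simp [hg1, hh1], by simp [sec_mul, hh1], fun w hw hwx => ?_⟩
    simp [sec_mul, hh1, hgT w hw hwx, hhT w hw hwx]
  inv_mem' := by
    rintro _ ⟨g, hg, hg1, rfl, hgT⟩
    refine ⟨g⁻¹, inv_mem hg, by simp [hg1], by simp [sec_inv, hg1], fun w hw hwx => ?_⟩
    simp [sec_inv, hg1, hgT w hw hwx]

/-- For elements fixing the letters, states of commutators are commutators of states, so a
commutator is trivial below a letter as soon as one factor is: supports intersect. -/
theorem commutator_partialStates_le (K K' : Subgroup (TreeAut n)) (T T' : Set (Fin n)) (x : Fin n) :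
    ⁅partialStates K T x, partialStates K' T' x⁆ ≤ partialStates ⁅K, K'⁆ (T ∩ T') x := by
  rw [Subgroup.commutator_le]
  rintro _ ⟨g, hg, hg1, rfl, hgT⟩ _ ⟨h, hh, hh1, rfl, hhT⟩
  have hs : ∀ w, sec ⁅g, h⁆ w = ⁅sec g w, sec h w⁆ := fun w => by
    simp [commutatorElement_def, sec_mul, sec_inv, hg1, hh1]
  refine ⟨⁅g, h⁆, Subgroup.commutator_mem_commutator hg hh, ?_, hs x, fun w hw hwx => ?_⟩
  · simp [commutatorElement_def, hg1, hh1]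
  · rw [hs]
    by_cases hT : w ∈ T
    · rw [hhT w (fun h' => hw ⟨hT, h'⟩) hwx, commutatorElement_one_right]
    · rw [hgT w hT hwx, commutatorElement_one_left]

theorem single_mem_of_mem_partialStates {K : Subgroup (TreeAut n)} {x : Fin n} {g : TreeAut n}
    (h : g ∈ partialStates K ∅ x) : single x g ∈ K := by
  obtain ⟨h, hh, hh1, rfl, hhT⟩ := h
  rwa [← eq_single_of_sec hh1 fun y hy => hhT y (Set.notMem_empty y) hy]

/-- Writing ⁅g, h⁆ = g · (h g⁻¹ h⁻¹), the class vector of `g` is divided by its translate under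
`root h`. -/
theorem secClass_commutator {g h : TreeAut n} (hg : g ∈ hanoiGroup n) (hh : h ∈ hanoiGroup n)
    (hg1 : root g = 1) (x : Fin n) :
    secClass ⁅g, h⁆ x = secClass g x * (secClass g ((root h)⁻¹ x))⁻¹ := by
  have hr : root g⁻¹ = 1 := by rw [root_inv, hg1, inv_one]
  have hr' : root (h * g⁻¹ * h⁻¹) = 1 := by
    rw [root_mul, root_mul, hr, root_inv, mul_one, mul_inv_cancel]
  rw [commutatorElement_def, mul_assoc, mul_assoc, ← mul_assoc h,
    secClass_mul hg (mul_mem (mul_mem hh (inv_mem hg)) (inv_mem hh)),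
    secClass_conj hh (inv_mem hg) hr, secClass_inv hg, hr', hg1]
  rfl

theorem root_commutator {g h : TreeAut n} (hg1 : root g = 1) : root ⁅g, h⁆ = 1 := by
  simp [commutatorElement_def, hg1]

section

variable [NeZero n]

/-- The cube of a_i a_{i+1}⁻¹ is supported below i, i+1, i+2 and has the state a_i a_{i+1}⁻¹ at `i`.
Conjugating it by an element with state `g` at `i` that moves these letters to `x` and the pair `y`,
`z` gives each generator of E as a state at `x`. -/
theorem hanoiEven_le_partialStates (hn : 3 ≤ n) {x y z : Fin n} (hyx : y ≠ x) (hzx : z ≠ x)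
    (hyz : y ≠ z) : hanoiEven n ≤ partialStates (hanoiEven n) {y, z} x := by
  conv_lhs => rw [hanoiEven]
  rw [Subgroup.closure_le]
  rintro _ ⟨g, hg, i, rfl⟩
  obtain ⟨c1, c2, c3, c4, c5⟩ := root_sec_adj_cube hn i
  obtain ⟨k, hk, h1, h2, h3⟩ := exists_root_triple hn hg (Fin.add_one_ne_self hn i)
    (Fin.add_one_add_one_ne_self hn i) (Fin.add_one_ne_self hn (i + 1)).symm hyx hzx hyz
  refine ⟨k * hanoiQuot i (i + 1) ^ 3 * k⁻¹,
    conj_mem_hanoiEven hk (pow_mem (hanoiQuot_add_one_mem i) 3), ?_, ?_, fun w hw hwx => ?_⟩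
  · rw [root_mul, root_mul, c1, root_inv, mul_one, mul_inv_cancel]
  · rw [← h1, sec_conj, c1, c2, h2, Equiv.Perm.one_apply, h2]
  · obtain ⟨v, rfl⟩ := (root k).surjective w
    rw [sec_conj, c1, Equiv.Perm.one_apply, c5, mul_one, mul_inv_cancel]
    · rintro rfl; exact hwx h1
    · rintro rfl
      rcases h3 with ⟨e, -⟩ | ⟨e, -⟩ <;> exact hw (by simp [e])
    · rintro rfl
      rcases h3 with ⟨-, e⟩ | ⟨-, e⟩ <;> exact hw (by simp [e])

/-- With three letters `y`, `z`, `w` besides `x`, the supports {y,z}, {y,w}, {z,w} have empty common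
intersection. A double commutator therefore reduces the support to `x`, which explains both the
third term of the lower central series and n ≥ 4. -/
theorem single_mem_commutator (hn : 4 ≤ n) (x : Fin n) {b : TreeAut n}
    (hb : b ∈ ⁅⁅hanoiEven n, hanoiEven n⁆, hanoiEven n⁆) :
    single x b ∈ ⁅⁅hanoiEven n, hanoiEven n⁆, hanoiEven n⁆ := by
  have hcard : 3 ≤ (Finset.univ.erase x).card := by
    rw [Finset.card_erase_of_mem (Finset.mem_univ x), Finset.card_univ, Fintype.card_fin]
    omega
  obtain ⟨y, z, w, hy, hz, hw, hyz, hyw, hzw⟩ := Finset.two_lt_card_iff.1 hcard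
  simp only [Finset.mem_erase, Finset.mem_univ, and_true] at hy hz hw
  have hn3 : 3 ≤ n := by omega
  have h1 : ⁅hanoiEven n, hanoiEven n⁆ ≤ partialStates ⁅hanoiEven n, hanoiEven n⁆ {y} x := by
    have h := commutator_partialStates_le (hanoiEven n) (hanoiEven n) {y, z} {y, w} x
    rw [show ({y, z} ∩ {y, w} : Set (Fin n)) = {y} by ext u; simp; grind] at h
    exact (Subgroup.commutator_mono (hanoiEven_le_partialStates hn3 hy hz hyz)
      (hanoiEven_le_partialStates hn3 hy hw hyw)).trans h
  have h2 := commutator_partialStates_le ⁅hanoiEven n, hanoiEven n⁆ (hanoiEven n) {y} {z, w} x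
  rw [show ({y} ∩ {z, w} : Set (Fin n)) = ∅ by ext u; simp; grind] at h2
  exact single_mem_of_mem_partialStates (h2 (Subgroup.commutator_mono h1
    (hanoiEven_le_partialStates hn3 hz hw hzw) hb))

theorem conj_mem_commutator {g b : TreeAut n} (hg : g ∈ hanoiGroup n)
    (hb : b ∈ ⁅⁅hanoiEven n, hanoiEven n⁆, hanoiEven n⁆) :
    g * b * g⁻¹ ∈ ⁅⁅hanoiEven n, hanoiEven n⁆, hanoiEven n⁆ := by
  have hE : (hanoiEven n).map (MulAut.conj g).toMonoidHom ≤ hanoiEven n := by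
    rintro _ ⟨e, he, rfl⟩
    exact conj_mem_hanoiEven hg he
  have h : g * b * g⁻¹ ∈
      (⁅⁅hanoiEven n, hanoiEven n⁆, hanoiEven n⁆).map (MulAut.conj g).toMonoidHom := ⟨b, hb, rfl⟩
  rw [Subgroup.map_commutator, Subgroup.map_commutator] at h
  exact Subgroup.commutator_mono (Subgroup.commutator_mono hE hE) hE h

theorem commutator_hanoiEven_le :
    ⁅⁅hanoiEven n, hanoiEven n⁆, hanoiEven n⁆ ≤ hanoiGroup n := by
  rw [Subgroup.commutator_le]
  intro a ha b hb
  have ha' : a ∈ hanoiGroup n :=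
    (Subgroup.commutator_le.2 fun x hx y hy => by
      have hx' := hanoiEven_le hx
      have hy' := hanoiEven_le hy
      exact mul_mem (mul_mem (mul_mem hx' hy') (inv_mem hx')) (inv_mem hy')) ha
  have hb' := hanoiEven_le hb
  exact mul_mem (mul_mem (mul_mem ha' hb') (inv_mem ha')) (inv_mem hb')

theorem commutator_alternatingGroup_le_map (hn : 3 ≤ n) :
    ⁅⁅alternatingGroup (Fin n), alternatingGroup (Fin n)⁆, alternatingGroup (Fin n)⁆ ≤
      (⁅⁅hanoiEven n, hanoiEven n⁆, hanoiEven n⁆).map (rootHom n) := by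
  have h := alternatingGroup_le_map_hanoiEven hn
  rw [Subgroup.map_commutator, Subgroup.map_commutator]
  exact Subgroup.commutator_mono (Subgroup.commutator_mono h h) h

/-- From an element with different classes below two letters, one gets all the vectors of classes
with two inverse entries. -/
theorem hasBranchingSubgroup_of_secClass (hn : 4 ≤ n)
    (hroot : ⁅sigmaGroup n, sigmaGroup n⁆ ≤
      ⁅⁅alternatingGroup (Fin n), alternatingGroup (Fin n)⁆, alternatingGroup (Fin n)⁆)
    {g : TreeAut n} (hg : g ∈ hanoiEven n) (hg1 : root g = 1) {p q r s : Fin n} (hpq : p ≠ q)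
    (hpr : p ≠ r) (hps : p ≠ s) (hqr : q ≠ r) (hqs : q ≠ s) (hrs : r ≠ s)
    (hv : secClass g r = secClass g s)
    (hz : ∀ a, a ∈ Subgroup.zpowers (secClass g p * (secClass g q)⁻¹)) :
    HasBranchingSubgroup n := by
  have hn3 : 3 ≤ n := by omega
  refine ⟨_, commutator_hanoiEven_le, fun g hg b hb => conj_mem_commutator hg hb,
    fun x b hb => single_mem_commutator hn x hb,
    hroot.trans (commutator_alternatingGroup_le_map hn3), p, r, hpr, fun a => ?_⟩
  set β := secClass g p * (secClass g q)⁻¹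
  have hgG := hanoiEven_le hg
  obtain ⟨h, hh, hhr⟩ := alternatingGroup_le_map_hanoiEven hn3
    (Equiv.Perm.mul_mem_alternatingGroup_of_isSwap (⟨p, q, hpq, rfl⟩ : (Equiv.swap p q).IsSwap)
      (⟨r, s, hrs, rfl⟩ : (Equiv.swap r s).IsSwap))
  obtain ⟨h', hh', hhr'⟩ := exists_hanoiEven_root_cyc3 hn3 hpr hps hrs
  rw [rootHom_apply] at hhr hhr'
  have hhG := hanoiEven_le hh
  have hhG' := hanoiEven_le hh'
  have hkG : ⁅g, h⁆ ∈ hanoiGroup n :=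
    mul_mem (mul_mem (mul_mem hgG hhG) (inv_mem hgG)) (inv_mem hhG)
  -- Here `h` acts as (p q)(r s), an even permutation. The equality of the classes at `r` and `s`
  -- kills those two entries.
  have hk : secClass ⁅g, h⁆ = Pi.mulSingle p β * Pi.mulSingle q β⁻¹ := by
    funext x
    rw [secClass_commutator hgG hhG hg1, hhr, mul_inv_rev, Equiv.swap_inv, Equiv.swap_inv,
      Equiv.Perm.mul_apply, Pi.mul_apply, Pi.mulSingle_apply, Pi.mulSingle_apply]
    by_cases hxp : x = p
    · subst hxp
      rw [Equiv.swap_apply_left, Equiv.swap_apply_of_ne_of_ne hqr hqs]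
      simp [hpq, β]
    by_cases hxq : x = q
    · subst hxq
      rw [Equiv.swap_apply_right, Equiv.swap_apply_of_ne_of_ne hpr hps]
      simp [hpq.symm, β]
    rw [Equiv.swap_apply_of_ne_of_ne hxp hxq]
    by_cases hxr : x = r
    · subst hxr
      rw [Equiv.swap_apply_left, hv]
      simp [hxp, hxq]
    by_cases hxs : x = s
    · subst hxs
      rw [Equiv.swap_apply_right, hv]
      simp [hxp, hxq]
    rw [Equiv.swap_apply_of_ne_of_ne hxr hxs]
    simp [hxp, hxq]
  -- Here `h'` acts as (p r s): it fixes `q`, whose entry cancels, and carries the entry at `p` to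
  -- `r`. The second commutator puts the element into [[E,E],E].
  have hk' : secClass ⁅⁅g, h⁆, h'⁆ = Pi.mulSingle p β * Pi.mulSingle r β⁻¹ := by
    have e1 := mulSingle_comp_symm (cyc3 p r s) p β
    have e2 := mulSingle_comp_symm (cyc3 p r s) q β⁻¹
    rw [cyc3_apply_left hpr hps] at e1
    rw [cyc3_apply_of_ne hpq.symm hqr hqs] at e2
    funext x
    rw [secClass_commutator hkG hhG' (root_commutator hg1), hhr', hk, Pi.mul_apply, Pi.mul_apply,
      congrFun e1, congrFun e2, Pi.mul_apply]
    simp only [Pi.mulSingle_inv, Pi.inv_apply]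
    group
  obtain ⟨j, hj⟩ := hz a
  have hmem : secClass ⁅⁅g, h⁆, h'⁆ ∈ classVectors (commutator_hanoiEven_le (n := n)) :=
    ⟨_, Subgroup.commutator_mem_commutator (Subgroup.commutator_mem_commutator hg hh) hh',
      root_commutator (root_commutator hg1), rfl⟩
  have := zpow_mem hmem j
  rw [hk', mul_zpow, ← Pi.mulSingle_zpow, ← Pi.mulSingle_zpow, inv_zpow] at this
  simp only at hj
  rwa [hj] at this

end

end TreeAut

/-! ### Commutators and orders of the permutation groups involved -/

open scoped commutatorElement

theorem commutator_le_alternatingGroup {α : Type*} [Fintype α] [DecidableEq α]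
    (T : Subgroup (Equiv.Perm α)) : ⁅T, T⁆ ≤ alternatingGroup α :=
  (Subgroup.commutator_mono le_top le_top).trans alternatingGroup.commutator_perm_le

theorem commutator_top_perm (α : Type*) [Fintype α] [DecidableEq α] :
    ⁅(⊤ : Subgroup (Equiv.Perm α)), (⊤ : Subgroup (Equiv.Perm α))⁆ = alternatingGroup α := by
  refine le_antisymm (commutator_le_alternatingGroup ⊤)
    (alternatingGroup_le_of_cyc3_mem fun x y z hxy _ hyz => ?_)
  have h : cyc3 x y z = ⁅Equiv.swap x y, Equiv.swap x z⁆ := by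
    rw [commutatorElement_def, mul_assoc, mul_assoc, ← mul_assoc (Equiv.swap x z), Equiv.swap_inv x y,
      ← Equiv.swap_apply_apply, Equiv.swap_apply_left, Equiv.swap_apply_of_ne_of_ne hxy.symm hyz,
      cyc3, Equiv.swap_comm z y]
  rw [h]
  exact Subgroup.commutator_mem_commutator trivial trivial

theorem card_abelianization_mul {G : Type*} [Group G] (T : Subgroup G) :
    Nat.card (Abelianization T) * Nat.card (⁅T, T⁆ : Subgroup G) = Nat.card T := by
  rw [← Subgroup.map_subtype_commutator, Subgroup.card_map_of_injective T.subtype_injective,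
    mul_comm]
  exact (commutator T).card_mul_index

theorem card_commutator_alternatingGroup_four :
    Nat.card (⁅alternatingGroup (Fin 4), alternatingGroup (Fin 4)⁆ : Subgroup _) = 4 := by
  rw [← Subgroup.map_subtype_commutator, Subgroup.card_map_of_injective (Subgroup.subtype_injective _),
    ← alternatingGroup.kleinFour_eq_commutator (by simp),
    alternatingGroup.kleinFour_card_of_card_eq_four (by simp)]

/-- Although B is a double commutator, its action on the letters still contains [Σ,Σ]. For n ≥ 5 the
alternating group is perfect; for n = 4 the double commutator has order dividing 4 and more than two
elements. -/
theorem commutator_alternatingGroup_le (n : ℕ) (hn : 4 ≤ n) :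
    ⁅alternatingGroup (Fin n), alternatingGroup (Fin n)⁆ ≤
      ⁅⁅alternatingGroup (Fin n), alternatingGroup (Fin n)⁆, alternatingGroup (Fin n)⁆ := by
  rcases hn.eq_or_lt with rfl | hn
  · have hA : (alternatingGroup (Fin 4)).Normal := inferInstance
    set A := alternatingGroup (Fin 4)
    have hle : ⁅⁅A, A⁆, A⁆ ≤ ⁅A, A⁆ := Subgroup.commutator_le_left _ _
    refine (Subgroup.eq_of_le_of_card_ge hle ?_).ge
    rw [card_commutator_alternatingGroup_four]
    have hdvd := Subgroup.card_dvd_of_le hle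
    rw [card_commutator_alternatingGroup_four] at hdvd
    have hc : ∀ x y z : Fin 4, x ≠ y → y ≠ z → cyc3 x y z ∈ A :=
      fun x y z => cyc3_mem_alternatingGroup
    have hd : ∀ x y z : Fin 4, x ≠ y → y ≠ z →
        ⁅⁅cyc3 (0 : Fin 4) 1 2, cyc3 (0 : Fin 4) 1 3⁆, cyc3 x y z⁆ ∈ ⁅⁅A, A⁆, A⁆ := fun x y z h1 h2 =>
      Subgroup.commutator_mem_commutator (Subgroup.commutator_mem_commutator
        (hc 0 1 2 (by decide) (by decide)) (hc 0 1 3 (by decide) (by decide))) (hc x y z h1 h2)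
    have h3 : 2 < Nat.card (⁅⁅A, A⁆, A⁆ : Subgroup _) := by
      change 2 < Nat.card ((⁅⁅A, A⁆, A⁆ : Subgroup (Equiv.Perm (Fin 4))) : Set (Equiv.Perm (Fin 4)))
      rw [Nat.card_coe_set_eq, Set.two_lt_ncard_iff (Set.toFinite _)]
      exact ⟨_, _, _, one_mem _, hd 0 1 2 (by decide) (by decide), hd 0 2 1 (by decide) (by decide),
        by decide, by decide, by decide⟩
    have := Nat.le_of_dvd (by norm_num) hdvd
    interval_cases h : Nat.card (⁅⁅A, A⁆, A⁆ : Subgroup _)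
    · omega
    · omega
  · rw [commutator_alternatingGroup_eq_self (by simp; omega),
      commutator_alternatingGroup_eq_self (by simp; omega)]

section SigmaGroup

variable {n : ℕ}

theorem alternatingGroup_le_sigmaGroup (hn : 3 ≤ n) : alternatingGroup (Fin n) ≤ sigmaGroup n := by
  have : NeZero n := ⟨by omega⟩
  rw [← TreeAut.map_rootHom_hanoiGroup]
  exact (TreeAut.alternatingGroup_le_map_hanoiEven hn).trans
    (Subgroup.map_mono TreeAut.hanoiEven_le)

theorem sign_sigmaPerm (hn : 3 ≤ n) (i : Fin n) :
    Equiv.Perm.sign (sigmaPerm n i) = -(-1) ^ (n - 1) := by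
  obtain ⟨m, rfl⟩ : ∃ m, n = m + 3 := ⟨n - 3, by omega⟩
  exact sigmaPerm_sign i

theorem sign_sigmaPerm_of_odd (hn : 3 ≤ n) (hodd : Odd n) (i : Fin n) :
    Equiv.Perm.sign (sigmaPerm n i) = -1 := by
  rw [sign_sigmaPerm hn, (Nat.Odd.sub_odd hodd odd_one).neg_one_pow]

theorem sigmaPerm_mem (i : Fin n) : sigmaPerm n i ∈ sigmaGroup n := Subgroup.subset_closure ⟨i, rfl⟩

theorem sigmaGroup_of_odd (hn : 3 ≤ n) (hodd : Odd n) : sigmaGroup n = ⊤ := by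
  rw [eq_top_iff]
  intro p _
  rcases Int.units_eq_one_or (Equiv.Perm.sign p) with h | h
  · exact alternatingGroup_le_sigmaGroup hn h
  · let i : Fin n := ⟨0, by omega⟩
    have h2 : sigmaPerm n i * p ∈ alternatingGroup (Fin n) := by
      rw [Equiv.Perm.mem_alternatingGroup, map_mul, h, sign_sigmaPerm_of_odd hn hodd]
      rfl
    have h3 := mul_mem (inv_mem (sigmaPerm_mem i)) (alternatingGroup_le_sigmaGroup hn h2)
    rwa [inv_mul_cancel_left] at h3

theorem sigmaGroup_of_even (hn : 3 ≤ n) (heven : Even n) : sigmaGroup n = alternatingGroup (Fin n) := by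
  refine le_antisymm ?_ (alternatingGroup_le_sigmaGroup hn)
  rw [sigmaGroup, Subgroup.closure_le]
  rintro _ ⟨i, rfl⟩
  change Equiv.Perm.sign _ = 1
  rw [sign_sigmaPerm hn, (Nat.Even.sub_odd (by omega) heven odd_one).neg_one_pow, neg_neg]

theorem two_mul_card_alternatingGroup_fin (hn : 3 ≤ n) :
    2 * Nat.card (alternatingGroup (Fin n)) = n.factorial := by
  have : Nontrivial (Fin n) := Fin.nontrivial_iff_two_le.2 (by omega)
  rw [two_mul_nat_card_alternatingGroup, Nat.card_perm]
  simp

theorem card_abelianization_of_odd (hn : 3 ≤ n) (hodd : Odd n) :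
    Nat.card (Abelianization (sigmaGroup n)) = 2 := by
  have h := card_abelianization_mul (sigmaGroup n)
  rw [show ⁅sigmaGroup n, sigmaGroup n⁆ = alternatingGroup (Fin n) by
    rw [sigmaGroup_of_odd hn hodd, commutator_top_perm], show Nat.card (sigmaGroup n) =
    n.factorial by rw [sigmaGroup_of_odd hn hodd, Subgroup.card_top, Nat.card_perm]; simp,
    ← two_mul_card_alternatingGroup_fin hn] at h
  exact Nat.eq_of_mul_eq_mul_right Nat.card_pos h

theorem card_abelianization_of_even (hn : 5 ≤ n) (heven : Even n) :
    Nat.card (Abelianization (sigmaGroup n)) = 1 := by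
  have h := card_abelianization_mul (sigmaGroup n)
  rw [show ⁅sigmaGroup n, sigmaGroup n⁆ = sigmaGroup n by
    rw [sigmaGroup_of_even (by omega) heven,
      commutator_alternatingGroup_eq_self (by simpa using hn)]] at h
  exact Nat.eq_of_mul_eq_mul_right Nat.card_pos (h.trans (one_mul _).symm)

theorem card_sigmaGroup_four : Nat.card (sigmaGroup 4) = 12 := by
  have h2 := two_mul_card_alternatingGroup_fin (n := 4) (by omega)
  rw [sigmaGroup_of_even (by omega) (by decide)]
  have : Nat.factorial 4 = 24 := rfl
  omega

theorem card_abelianization_four : Nat.card (Abelianization (sigmaGroup 4)) = 3 := by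
  have h := card_abelianization_mul (sigmaGroup 4)
  rw [card_sigmaGroup_four] at h
  rw [show Nat.card (⁅sigmaGroup 4, sigmaGroup 4⁆ : Subgroup _) = 4 by
    rw [sigmaGroup_of_even (by omega) (by decide), card_commutator_alternatingGroup_four]] at h
  omega

theorem abClass_sigmaPerm_ne_one (hn : 3 ≤ n) (hodd : Odd n) (i : Fin n) :
    abClass (sigmaGroup n) (sigmaPerm n i) ≠ 1 := by
  intro h
  rw [abClass_eq_one_iff (sigmaPerm_mem i)] at h
  have h1 : Equiv.Perm.sign _ = 1 := commutator_le_alternatingGroup _ h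
  rw [sign_sigmaPerm_of_odd hn hodd] at h1
  exact absurd h1 (by decide)

end SigmaGroup

/-! ### Branching subgroups case by case -/

namespace TreeAut

/-- Here Σ is perfect, the class vectors are trivial, and `g = 1` suffices. -/
theorem hasBranchingSubgroup_of_even {n : ℕ} [NeZero n] (hn : 5 ≤ n) (heven : Even n) :
    HasBranchingSubgroup n := by
  have hS := sigmaGroup_of_even (by omega) heven
  have : Subsingleton (Abelianization (sigmaGroup n)) :=
    (Nat.card_eq_one_iff_unique.1 (card_abelianization_of_even hn heven)).1
  refine hasBranchingSubgroup_of_secClass (by omega) ?_ (one_mem (hanoiEven n)) root_one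
    (p := ⟨0, by omega⟩) (q := ⟨1, by omega⟩) (r := ⟨2, by omega⟩) (s := ⟨3, by omega⟩)
    (by simp) (by simp) (by simp) (by simp) (by simp) (by simp) (Subsingleton.elim _ _)
    fun a => ?_
  · rw [hS]
    exact commutator_alternatingGroup_le n (by omega)
  · rw [Subsingleton.elim a 1]
    exact one_mem _

/-- The cube of a_0 a_1⁻¹ has equal states at the letters 0 and 1, a trivial state at 3, and at 2
the state a_1⁻¹ a_0, whose class is that of a three-cycle and generates A_4^ab. -/
theorem hasBranchingSubgroup_four : HasBranchingSubgroup 4 := by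
  obtain ⟨c1, c2, c3, c4, c5⟩ := root_sec_adj_cube (n := 4) (by omega) 0
  have hp : secClass (hanoiQuot (0 : Fin 4) (0 + 1) ^ 3) 2 =
      abClass (sigmaGroup 4) (cyc3 0 1 2) := by
    have h : abClass (sigmaGroup 4) (root (hanoiQuot (0 : Fin 4) (0 + 1))) =
      abClass (sigmaGroup 4) (cyc3 0 1 2) := by rw [root_adj (by omega)]; rfl
    rw [← h, secClass, show (2 : Fin 4) = 0 + 1 + 1 from rfl, c4, hanoiQuot, root_mul, root_mul,
      root_inv, root_hanoiGen, root_hanoiGen, abClass_mul (inv_mem (sigmaPerm_mem _))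
      (sigmaPerm_mem _), abClass_mul (sigmaPerm_mem _) (inv_mem (sigmaPerm_mem _)), mul_comm]
  have hq : secClass (hanoiQuot (0 : Fin 4) (0 + 1) ^ 3) 3 = 1 := by
    rw [secClass, c5 3 (by decide) (by decide) (by decide), root_one, abClass_one]
  have hmem : cyc3 (0 : Fin 4) 1 2 ∈ sigmaGroup 4 :=
    alternatingGroup_le_sigmaGroup (by omega) (cyc3_mem_alternatingGroup (by decide) (by decide))
  refine hasBranchingSubgroup_of_secClass (by omega) ?_
    (pow_mem (hanoiQuot_add_one_mem (0 : Fin 4)) 3) c1 (p := 2) (q := 3) (r := 0) (s := 1)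
    (by decide) (by decide) (by decide) (by decide) (by decide) (by decide) ?_ fun a => ?_
  · rw [sigmaGroup_of_even (by omega) (by decide)]
    exact commutator_alternatingGroup_le 4 (by omega)
  · rw [secClass, secClass, c2]
    exact congrArg _ (congrArg _ c3.symm)
  · rw [hp, hq, inv_one, mul_one]
    have : Fact (Nat.Prime 3) := ⟨by norm_num⟩
    refine mem_zpowers_of_prime_card card_abelianization_four fun h => ?_
    rw [abClass_eq_one_iff hmem, sigmaGroup_of_even (by omega) (by decide)] at h
    -- An element of order 3 cannot lie in the commutator subgroup of A_4, which has order 4.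
    have hord := Subgroup.orderOf_dvd_natCard _ h
    rw [card_commutator_alternatingGroup_four, orderOf_eq_prime (p := 3) (by decide) (by decide)]
      at hord
    omega

/-- The square of a_0 a_2⁻¹ has state a_0 at the letters 0 and 1, a_2⁻¹ at 2 and 1 at 4. As σ_2 is
odd, its class generates Σ^ab. Letter 4, outside the support, is where n ≥ 5 is used. -/
theorem hasBranchingSubgroup_of_odd {n : ℕ} [NeZero n] (hn : 5 ≤ n) (hodd : Odd n) :
    HasBranchingSubgroup n := by
  have hsucc : ∀ k (hk : k + 1 < n), (⟨k, by omega⟩ : Fin n) + 1 = ⟨k + 1, hk⟩ := fun k hk =>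
    Fin.ext (by
      rw [Fin.val_add, Fin.coe_ofNat_eq_mod, Nat.mod_eq_of_lt (a := 1) (by omega)]
      exact Nat.mod_eq_of_lt hk)
  have h0 := hsucc 0 (by omega)
  have h1 := hsucc 1 (by omega)
  have h2 := hsucc 2 (by omega)
  obtain ⟨c1, c2, c3, c4, c5⟩ := root_sec_nonadj_sq (n := n) (by omega)
    (i := ⟨0, by omega⟩) (j := ⟨2, by omega⟩) (by simp)
    (by rw [h0]; simp) (by rw [h2]; simp)
  rw [h0] at c3
  have hq : secClass (hanoiQuot (⟨0, by omega⟩ : Fin n) ⟨2, by omega⟩ ^ 2) ⟨4, by omega⟩ = 1 := by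
    rw [secClass, c5 _ (by simp) (by rw [h0]; simp) (by simp) (by rw [h2]; simp), root_one, abClass_one]
  have hg : hanoiQuot (⟨0, by omega⟩ : Fin n) ⟨2, by omega⟩ ∈ hanoiEven n := by
    -- The product telescopes: a_0 a_2⁻¹ = (a_0 a_1⁻¹)(a_1 a_2⁻¹).
    have := mul_mem (hanoiQuot_add_one_mem (⟨0, by omega⟩ : Fin n))
      (hanoiQuot_add_one_mem (⟨1, by omega⟩ : Fin n))
    rwa [h0, h1, hanoiQuot, hanoiQuot, mul_assoc, inv_mul_cancel_left] at this
  refine hasBranchingSubgroup_of_secClass (by omega) ?_ (pow_mem hg 2) c1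
    (p := ⟨2, by omega⟩) (q := ⟨4, by omega⟩) (r := ⟨0, by omega⟩) (s := ⟨1, by omega⟩)
    (by simp) (by simp) (by simp) (by simp) (by simp) (by simp) ?_ fun a => ?_
  · rw [commutator_alternatingGroup_eq_self (by simpa using hn),
      commutator_alternatingGroup_eq_self (by simpa using hn)]
    exact commutator_le_alternatingGroup _
  · rw [secClass, secClass, c2, c3]
  · rw [hq, secClass, c4, inv_one, mul_one, root_inv, root_hanoiGen,
      abClass_inv (sigmaPerm_mem _)]
    have : Fact (Nat.Prime 2) := ⟨Nat.prime_two⟩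
    exact mem_zpowers_of_prime_card (card_abelianization_of_odd (by omega) hodd)
      (inv_ne_one.2 (abClass_sigmaPerm_ne_one (by omega) hodd _))

theorem conj_single (k g : TreeAut n) (x : Fin n) :
    k * single x g * k⁻¹ = single (root k x) (sec k x * g * (sec k x)⁻¹) := by
  have h : root (k * single x g * k⁻¹) = 1 := by simp
  have hx := sec_conj k (single x g) x
  rw [root_single, Equiv.Perm.one_apply, sec_single_same] at hx
  rw [← hx]
  refine eq_single_of_sec h fun y hy => ?_
  obtain ⟨z, rfl⟩ := (root k).surjective y
  have hz : z ≠ x := fun h => hy (h ▸ rfl)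
  rw [sec_conj, root_single, sec_single_of_ne hz, mul_one, Equiv.Perm.one_apply, mul_inv_cancel]

/-! ### The case n = 3 -/

section Three

theorem sigmaPerm_three {i j k : Fin 3} (hij : i ≠ j) (hik : i ≠ k) (hjk : j ≠ k) :
    sigmaPerm 3 i = Equiv.swap j k := by
  revert i j k
  decide

/-- The square fixes the letters and its only possibly nontrivial state is again the square, so it
lies in every level stabilizer. -/
theorem hanoiGen_three_mul_self (i : Fin 3) : hanoiGen 3 i * hanoiGen 3 i = 1 := by
  have hs : ∀ i, sigmaPerm 3 i * sigmaPerm 3 i = 1 := by decide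
  have h : ∀ m, hanoiGen 3 i * hanoiGen 3 i ∈ levelStab 3 m := by
    intro m
    induction m with
    | zero => rw [levelStab_zero]; trivial
    | succ m ih =>
      refine mem_levelStab_succ.2 ⟨by rw [root_mul, root_hanoiGen, hs], fun x => ?_⟩
      rw [sec_mul, root_hanoiGen, sec_hanoiGen, sec_hanoiGen]
      by_cases hx : x = i
      · subst hx
        rw [sigmaPerm_self, if_pos rfl]
        exact ih
      · rw [if_neg hx, if_neg fun h => hx ((sigmaPerm 3 i).injective (h.trans (sigmaPerm_self i).symm)),
          one_mul]
        exact one_mem _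
  exact (eq_of_forall_mem_levelStab fun m => by simpa using h m).symm

theorem hanoiGen_three_inv (i : Fin 3) : (hanoiGen 3 i)⁻¹ = hanoiGen 3 i :=
  inv_eq_of_mul_eq_one_left (hanoiGen_three_mul_self i)

/-- Both a_i and a_j a_k a_j act as (j k), with states a_i and a_k at `i`. At `j` and `k` their
states are constant, 1 and a_j respectively, so the commutator is trivial there. -/
theorem single_commutator_hanoiGen {i j k : Fin 3} (hij : i ≠ j) (hik : i ≠ k) (hjk : j ≠ k) :
    single i ⁅hanoiGen 3 i, hanoiGen 3 k⁆ =
      ⁅hanoiGen 3 i, hanoiGen 3 j * hanoiGen 3 k * hanoiGen 3 j⁆ := by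
  have hi := sigmaPerm_three hij hik hjk
  have hj := sigmaPerm_three hij.symm hjk hik
  have hk := sigmaPerm_three hik.symm hjk.symm hij
  have key : ∀ i j k : Fin 3, i ≠ j → i ≠ k → j ≠ k → ∀ x, x = i ∨ x = j ∨ x = k := by decide
  simp only [commutatorElement_def, mul_inv_rev, hanoiGen_three_inv]
  refine ext_root_sec ?_ fun x => ?_
  · simp only [root_single, root_mul, root_hanoiGen]
    revert i j k
    decide
  · rcases key i j k hij hik hjk x with rfl | rfl | rfl <;>
    simp [sec_mul, sec_hanoiGen, hi, hj, hk, Equiv.swap_apply_of_ne_of_ne, hij, hik, hjk, hij.symm,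
      hik.symm, hjk.symm, hanoiGen_three_mul_self, mul_assoc]

theorem conj_mem_commutator_self {G : Type*} [Group G] {H : Subgroup G} {g b : G} (hg : g ∈ H)
    (hb : b ∈ ⁅H, H⁆) : g * b * g⁻¹ ∈ ⁅H, H⁆ := by
  have h : ⁅g, b⁆ * b ∈ ⁅H, H⁆ :=
    mul_mem (Subgroup.commutator_mem_commutator hg (Subgroup.commutator_le_self H hb)) hb
  rwa [commutatorElement_def, inv_mul_cancel_right] at h

theorem single_mem_commutator_three (x : Fin 3) {b : TreeAut 3}
    (hb : b ∈ ⁅hanoiGroup 3, hanoiGroup 3⁆) : single x b ∈ ⁅hanoiGroup 3, hanoiGroup 3⁆ := by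
  -- Self-replication lets one conjugation both move the letter and conjugate the state, so the
  -- commutator identities reduce everything to pairs of generators.
  have hconj : ∀ g ∈ hanoiGroup 3, ∀ b, ∀ i, single i b ∈ ⁅hanoiGroup 3, hanoiGroup 3⁆ →
      ∀ x, single x (g * b * g⁻¹) ∈ ⁅hanoiGroup 3, hanoiGroup 3⁆ := by
    intro g hg b i hb x
    obtain ⟨k, hk, hk1, hk2⟩ := exists_root_eq_sec_eq' le_rfl hg i x
    have := conj_mem_commutator_self hk hb
    rwa [conj_single, hk1, hk2] at this
  suffices h : ⁅hanoiGroup 3, hanoiGroup 3⁆ ≤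
      ⨅ x, (⁅hanoiGroup 3, hanoiGroup 3⁆ : Subgroup (TreeAut 3)).comap (single x) from
    Subgroup.mem_iInf.1 (h hb) x
  rw [Subgroup.commutator_le]
  intro g hg h hh
  rw [Subgroup.mem_iInf]
  simp only [Subgroup.mem_comap]
  induction hg, hh using Subgroup.closure_induction₂ with
  | mem g h hg hh =>
    obtain ⟨i, rfl⟩ := hg
    obtain ⟨k, rfl⟩ := hh
    intro x
    rcases eq_or_ne i k with rfl | hik
    · rw [commutatorElement_self, map_one]
      exact one_mem _
    · obtain ⟨j, hij, hjk⟩ : ∃ j, i ≠ j ∧ j ≠ k := by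
        revert i k
        decide
      have := single_commutator_hanoiGen hij hik hjk ▸ Subgroup.commutator_mem_commutator
        (hanoiGen_mem i) (mul_mem (mul_mem (hanoiGen_mem j) (hanoiGen_mem k)) (hanoiGen_mem j))
      simpa using hconj 1 (one_mem _) _ i this x
  | one_left h hh => simp
  | one_right h hh => simp
  | mul_left g g' h hg hg' hh h1 h2 =>
    intro x
    rw [show ⁅g * g', h⁆ = g * ⁅g', h⁆ * g⁻¹ * ⁅g, h⁆ by simp only [commutatorElement_def]; group,
      map_mul]
    exact mul_mem (hconj g hg _ 0 (h2 0) x) (h1 x)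
  | mul_right h h' g hh hh' hg h1 h2 =>
    intro x
    rw [show ⁅g, h * h'⁆ = ⁅g, h⁆ * (h * ⁅g, h'⁆ * h⁻¹) by simp only [commutatorElement_def]; group,
      map_mul]
    exact mul_mem (h1 x) (hconj h hh _ 0 (h2 0) x)
  | inv_left g h hg hh h1 =>
    intro x
    rw [show ⁅g⁻¹, h⁆ = (g⁻¹ * ⁅g, h⁆ * g⁻¹⁻¹)⁻¹ by simp only [commutatorElement_def]; group, map_inv]
    exact inv_mem (hconj _ (inv_mem hg) _ 0 (h1 0) x)
  | inv_right g h hg hh h1 =>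
    intro x
    rw [show ⁅g, h⁻¹⁆ = (h⁻¹ * ⁅g, h⁆ * h⁻¹⁻¹)⁻¹ by simp only [commutatorElement_def]; group, map_inv]
    exact inv_mem (hconj _ (inv_mem hh) _ 0 (h1 0) x)

theorem hasBranchingSubgroup_three : HasBranchingSubgroup 3 := by
  have hB : ⁅hanoiGroup 3, hanoiGroup 3⁆ ≤ hanoiGroup 3 := Subgroup.commutator_le_self _
  refine ⟨_, hB, fun g hg b hb => conj_mem_commutator_self hg hb,
    fun x b hb => single_mem_commutator_three x hb, ?_, 0, 2, by decide, fun a => ?_⟩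
  · rw [Subgroup.map_commutator, map_rootHom_hanoiGroup]
  -- This element fixes the letters and has class vector (ε, ε, 1). Dividing by its translate under
  -- a three-cycle gives (ε, 1, ε⁻¹), realised by a commutator.
  set c := hanoiGen 3 0 * hanoiGen 3 1 * hanoiGen 3 0 * hanoiGen 3 2 with hc
  have hcG : c ∈ hanoiGroup 3 := mul_mem (mul_mem (mul_mem (hanoiGen_mem 0) (hanoiGen_mem 1))
    (hanoiGen_mem 0)) (hanoiGen_mem 2)
  have hc1 : root c = 1 := by
    simp only [hc, root_mul, root_hanoiGen]
    decide
  have h0 : sigmaPerm 3 0 = Equiv.swap 1 2 := by decide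
  have h1 : sigmaPerm 3 1 = Equiv.swap 0 2 := by decide
  have h2 : sigmaPerm 3 2 = Equiv.swap 0 1 := by decide
  have hc2 : secClass c 0 = abClass (sigmaGroup 3) (sigmaPerm 3 0) := by
    simp [secClass, hc, sec_mul, sec_hanoiGen, h0, h1, h2]
  have hc3 : secClass c 1 = abClass (sigmaGroup 3) (sigmaPerm 3 0) := by
    simp [secClass, hc, sec_mul, sec_hanoiGen, h0, h1, h2, Equiv.swap_apply_of_ne_of_ne]
  have hc4 : secClass c 2 = 1 := by
    have h : root (sec c 2) = sigmaPerm 3 1 * sigmaPerm 3 2 := by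
      simp [hc, sec_mul, sec_hanoiGen, h0, h1, h2, Equiv.swap_apply_of_ne_of_ne]
    rw [secClass, h, abClass_eq_one_iff (mul_mem (sigmaPerm_mem _) (sigmaPerm_mem _)),
      sigmaGroup_of_odd le_rfl (by decide), commutator_top_perm, Equiv.Perm.mem_alternatingGroup]
    decide
  have hq := hanoiEven_le (hanoiQuot_add_one_mem (0 : Fin 3))
  set ε := abClass (sigmaGroup 3) (sigmaPerm 3 0)
  have hv : secClass ⁅c, hanoiQuot (0 : Fin 3) (0 + 1)⁆ = Pi.mulSingle 0 ε * Pi.mulSingle 2 ε⁻¹ := by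
    have hr : root (hanoiQuot (0 : Fin 3) (0 + 1)) = cyc3 0 1 2 := root_adj le_rfl 0
    have e0 : (cyc3 (0 : Fin 3) 1 2)⁻¹ 0 = 2 := by decide
    have e1 : (cyc3 (0 : Fin 3) 1 2)⁻¹ 1 = 0 := by decide
    have e2 : (cyc3 (0 : Fin 3) 1 2)⁻¹ 2 = 1 := by decide
    funext x
    rw [secClass_commutator hcG hq hc1, hr]
    match x with
    | 0 => simp [e0, hc2, hc4]
    | 1 => simp [e1, hc2, hc3]
    | 2 => simp [e2, hc3, hc4]
  have : Fact (Nat.Prime 2) := ⟨Nat.prime_two⟩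
  obtain ⟨j, hj⟩ := mem_zpowers_of_prime_card (g' := a) (card_abelianization_of_odd le_rfl (by decide))
    (abClass_sigmaPerm_ne_one le_rfl (by decide) 0)
  have hmem : secClass ⁅c, hanoiQuot (0 : Fin 3) (0 + 1)⁆ ∈ classVectors hB :=
    ⟨_, Subgroup.commutator_mem_commutator hcG hq, root_commutator hc1, rfl⟩
  have := zpow_mem hmem j
  rw [hv, mul_zpow, ← Pi.mulSingle_zpow, ← Pi.mulSingle_zpow, inv_zpow] at this
  simp only at hj
  rwa [hj] at this

end Three

/-! ### Evaluation of the dimension formula -/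

theorem log_card_levelOneGroup_of_odd {n : ℕ} (hn : 3 ≤ n) (hodd : Odd n) :
    Real.log (Nat.card (levelOneGroup n)) / (n * Real.log (n.factorial : ℝ)) =
      1 - Real.log 2 / (n * Real.log (n.factorial : ℝ)) := by
  have : NeZero n := ⟨by omega⟩
  have hpos := log_factorial_pos (n := n) (by omega)
  have hn0 : (0 : ℝ) < n := by exact_mod_cast (by omega : 0 < n)
  have h := congrArg (fun k : ℕ => Real.log k) (card_levelOneGroup (n := n))
  rw [card_abelianization_of_odd hn hodd, sigmaGroup_of_odd hn hodd, Subgroup.card_top,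
    Nat.card_perm, Nat.card_fin] at h
  have hN : (Nat.card (levelOneGroup n) : ℝ) ≠ 0 := by exact_mod_cast Nat.card_pos.ne'
  push_cast at h
  rw [Real.log_mul hN two_ne_zero, Real.log_pow] at h
  field_simp
  linarith

theorem log_card_levelOneGroup_of_even {n : ℕ} (hn : 5 ≤ n) (heven : Even n) :
    Real.log (Nat.card (levelOneGroup n)) / (n * Real.log (n.factorial : ℝ)) =
      1 - Real.log 2 / Real.log (n.factorial : ℝ) := by
  have : NeZero n := ⟨by omega⟩
  have hpos := log_factorial_pos (n := n) (by omega)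
  have hn0 : (0 : ℝ) < n := by exact_mod_cast (by omega : 0 < n)
  have h := congrArg (fun k : ℕ => Real.log k) (card_levelOneGroup (n := n))
  rw [card_abelianization_of_even hn heven, sigmaGroup_of_even (by omega) heven, mul_one] at h
  have h2 := congrArg (fun k : ℕ => Real.log k) (two_mul_card_alternatingGroup_fin (n := n) (by omega))
  have hA : (Nat.card (alternatingGroup (Fin n)) : ℝ) ≠ 0 := by exact_mod_cast Nat.card_pos.ne'
  push_cast at h h2
  rw [Real.log_mul two_ne_zero hA] at h2
  rw [Real.log_pow] at h
  rw [h, mul_div_mul_left _ _ hn0.ne', eq_sub_iff_add_eq, ← add_div, add_comm, h2,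
    div_self hpos.ne']

theorem log_card_levelOneGroup_four :
    Real.log (Nat.card (levelOneGroup 4)) / ((4 : ℕ) * Real.log (Nat.factorial 4 : ℝ)) =
      1 - Real.log 48 / Real.log 331776 := by
  have h := card_levelOneGroup (n := 4)
  rw [card_abelianization_four, card_sigmaGroup_four] at h
  -- The order is 12^4 / 3, and 331776 = 24^4 = 6912 · 48.
  have hN : Nat.card (levelOneGroup 4) = 6912 := by omega
  have h1 : ((4 : ℕ) : ℝ) * Real.log (Nat.factorial 4 : ℝ) = Real.log 331776 := by
    rw [← Real.log_pow]
    norm_num [Nat.factorial]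
  have h2 : Real.log 331776 = Real.log 6912 + Real.log 48 := by
    rw [← Real.log_mul (by norm_num) (by norm_num)]
    norm_num
  have h3 : 0 < Real.log 331776 := Real.log_pos (by norm_num)
  rw [h1, hN, eq_sub_iff_add_eq, ← add_div, div_eq_one_iff_eq h3.ne', h2]
  norm_num

end TreeAut

theorem theorem5p1 (n : ℕ) (hn : 3 ≤ n) (d : ℝ)
    (hd : d = if n = 4 then 1 - Real.log 48 / Real.log 331776
      else if Even n then 1 - Real.log 2 / Real.log (n.factorial : ℝ)
      else 1 - Real.log 2 / ((n : ℝ) * Real.log (n.factorial : ℝ))) :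
    dimH ((hanoiGroup n).topologicalClosure : Set (TreeAut n)) = ENNReal.ofReal d ∧
    Filter.liminf (fun m : ℕ =>
        Real.log ((TreeAut.levelStab n m).relIndex (hanoiGroup n).topologicalClosure : ℝ) /
          Real.log ((TreeAut.levelStab n m).index : ℝ)) Filter.atTop = d := by
  have : NeZero n := ⟨by omega⟩
  by_cases h4 : n = 4
  · subst h4
    rw [if_pos rfl, ← TreeAut.log_card_levelOneGroup_four] at hd
    rw [hd]
    exact TreeAut.hasBranchingSubgroup_four.dimH_eq hn
  rw [if_neg h4] at hd
  by_cases heven : Even n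
  · have hn5 : 5 ≤ n := by
      rcases heven with ⟨k, rfl⟩
      omega
    rw [if_pos heven, ← TreeAut.log_card_levelOneGroup_of_even hn5 heven] at hd
    rw [hd]
    exact (TreeAut.hasBranchingSubgroup_of_even hn5 heven).dimH_eq hn
  · have hodd := Nat.not_even_iff_odd.1 heven
    rw [if_neg heven, ← TreeAut.log_card_levelOneGroup_of_odd hn hodd] at hd
    rw [hd]
    rcases hn.eq_or_lt with rfl | hn3
    · exact TreeAut.hasBranchingSubgroup_three.dimH_eq hn
    · exact (TreeAut.hasBranchingSubgroup_of_odd (by omega) hodd).dimH_eq hn
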